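/- **Setting.** Let $\mathbb T=\mathbb R/\mathbb Z$, $\phi(t)=(2\pi)^{-1}\sin(2\pi t)$, and for $\kappa>0$ let $f_\kappa:\mathbb T^2\to\mathbb T^2$, $f_\kappa(x,y)=(y,-x+2y+\kappa\dot\phi(y))$ be the standard map. Let $\pi(x,y)=x$, $h_1(x)=\ddot\phi(x)+2/\kappa$ and $\tau=80\pi$; put $J(\kappa)=\{|h_1|<\tau\kappa^{-1/2}\}$, $\hat J(\kappa)=\{|h_1|<\tfrac{\tau}{10}\kappa^{-1/2}\}$, and let $\mathbf C(\kappa)=\pi^{-1}J(\kappa)$ be the critical set. The cyclicity of a periodic orbit is the number of its points in $\mathbf C(\kappa)$; a periodic point $p$ of least period $N$ is elliptic if $|\mathrm{Tr}\,df_\kappa^N(p)|<2$. For a sign $s$ let $K_{c}^{s}(\kappa)$ be the closure of the part of $J(\kappa)$ where $\dddot\phi$ has sign $s$, and $K_{d}^{s}(\kappa)$ the part of $\mathbb T\setminus\hat J(\kappa)$ where $h_1$ has sign $s$; mark the points $\xi_{c}^-=0$, $\xi_{d}^-=\frac14$, $\xi_{c}^+=\frac12$, $\xi_{d}^+=\frac34$.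 *Symbols.* A symbol is $a=(z,s'',s,w,s',k)$ with $z,w\in\{c,d\}$, signs $s'',s,s'$ and $k\in\mathbb Z$. Its region is the set of $p$ with $\pi f_\kappa^{-1}p\in K_z^{s''}$, $\pi p\in K_d^{s}$, $\pi f_\kappa p\in K_w^{s'}$. Its rectangle $R_a(\kappa)$ is the connected component of the region containing the point $p=(x,y)$ with $\pi f_\kappa^{-1}p=\xi_z^{s''}$, $\pi p\in K_d^s$, $\pi f_\kappa p=\xi_w^{s'}$ and $\lfloor s(\kappa\dot\phi(x)+2(x-\xi_d^s))+\xi_w^{s'}-\xi_z^{s''}\rfloor=k$, where $x$ is represented in $[0,1)$ (for given $z,s'',s,w,s'$ the number inside the floor runs over points of one coset of $\mathbb Z$, which is $\mathbb Z$ or $\mathbb Z+\frac12$). The symbol $a$ is $\kappa$-admissible if $p\mapsto(\pi f_\kappa^{-1}p,\pi f_\kappa p)$ is a diffeomorphism from $R_a(\kappa)$ onto $K_z^{s''}\times K_w^{s'}$. *Words.* A closed word of length $r\ge0$ is $\omega=\sigma\,a_1\cdots a_r\,\sigma'$ with signs $\sigma,\sigma'$ and symbols $a_i=(z_i,s_i'',s_i,w_i,s_i',k_i)$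 such that $z_i=c$ exactly for $i=1$, $w_i=c$ exactly for $i=r$, $s_i=s''_{i+1}$ and $s'_i=s_{i+1}$ for $1\le i<r$, and, if $r\ge1$, $\sigma=s''_1$ and $s'_r=\sigma'$. It is $\kappa$-admissible if all its symbols are. Its critical domain $\Delta_\omega(\kappa)$ is the set of $p$ with $\pi p\in K_c^{\sigma}$, $f_\kappa^l p\in R_{a_l}(\kappa)$ for $1\le l\le r$, and $\pi f_\kappa^{r+1}p\in K_c^{\sigma'}$. *Parameters.* For $n\in\mathbb N$ let $\kappa_a=\frac n2-\frac7{16}$, $\kappa_b=\frac n2+\frac7{16}$, $\mathcal K=\mathcal K(n)=[\kappa_a,\kappa_b]$, and let $\mathbb P$ be normalized Lebesgue measure on $\mathcal K$. For a closed word $\omega$ of length $N-1$ let $\mathcal K^{\mathrm a}_\omega=\{\kappa\in\mathcal K:\omega\text{ is }\kappa\text{-admissible}\}$, let $\Lambda_\omega=\inf_{\kappa\in\mathcal K_\omega^{\mathrm a}}\inf_{p\in\Delta_\omega(\kappa)}|\alpha_{0N}(p;\kappa)|$, where $\alpha_{0N}(p;\kappa)$ is the upper right entry of $df_\kappa^N(p)$,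 and let $\mathcal E_1(N,\omega)$ be the set of $\kappa\in\mathcal K^{\mathrm a}_\omega$ for which $\Delta_\omega(\kappa)$ contains an elliptic periodic point of least period $N$ and cyclicity $1$. **Lemma.** There are a constant $C>0$ and an $n_0$ such that for all $n\ge n_0$, all $N\ge1$ and all $\kappa_b$-admissible closed words $\omega$ of length $N-1$: (a) $\mathbb P(\mathcal E_1(N,\omega))\le C\,\kappa_a^{-1}\,\Lambda_\omega^{-2}$; (b) for every $\kappa\in\mathcal K^{\mathrm a}_\omega$ there is at most one elliptic periodic point of least period $N$ and cyclicity $1$ in $\Delta_\omega(\kappa)$. -/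

import Mathlib

open MeasureTheory ProbabilityTheory
open scoped ENNReal

noncomputable section

namespace StandardFamily

/-! ### The Chirikov–Taylor standard family -/

/-- The two-torus `𝕋² = (ℝ/ℤ)²`. -/
abbrev Torus : Type := UnitAddCircle × UnitAddCircle

/-- The first derivative `φ̇(t) = cos(2πt)` of the potential `φ(t) = (2π)⁻¹ sin(2πt)`,
as a function on `ℝ/ℤ`. -/
def dphi : UnitAddCircle → ℝ :=
  Function.Periodic.lift (f := fun t : ℝ => Real.cos (2 * Real.pi * t)) (c := 1) (by
    intro t
    simp only [mul_add, mul_one, Real.cos_add_two_pi])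

/-- The second derivative `φ̈(t) = -2π sin(2πt)` on `ℝ/ℤ`. -/
def ddphi : UnitAddCircle → ℝ :=
  Function.Periodic.lift
    (f := fun t : ℝ => -(2 * Real.pi) * Real.sin (2 * Real.pi * t)) (c := 1) (by
    intro t
    simp only [mul_add, mul_one, Real.sin_add_two_pi])

/-- The third derivative `-4π² cos(2πt)` of `φ` on `ℝ/ℤ`. -/
def dddphi : UnitAddCircle → ℝ :=
  Function.Periodic.lift
    (f := fun t : ℝ => -(2 * Real.pi) ^ 2 * Real.cos (2 * Real.pi * t)) (c := 1) (by
    intro t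
    simp only [mul_add, mul_one, Real.cos_add_two_pi])

/-- The standard map `f_κ(x, y) = (y, -x + 2y + κ φ̇(y)) mod ℤ²`, with its inverse
`f_κ⁻¹(x, y) = (2x - y + κ φ̇(x), x)`. -/
def stdMap (κ : ℝ) : Torus ≃ Torus where
  toFun p := (p.2, -p.1 + 2 • p.2 + ((κ * dphi p.2 : ℝ) : UnitAddCircle))
  invFun p := (2 • p.1 - p.2 + ((κ * dphi p.1 : ℝ) : UnitAddCircle), p.1)
  left_inv p := by
    ext
    · simp only; abel
    · rfl
  right_inv p := by
    ext
    · rfl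
    · simp only; abel

/-- The differential `d f_κ` at `p`, in the standard frame of `𝕋²`. -/
def jacobian (κ : ℝ) (p : Torus) : Matrix (Fin 2) (Fin 2) ℝ :=
  !![0, 1; -1, 2 + κ * ddphi p.2]

/-- The differential `A^{(k)} = d (f_κ^k)` at `p`, by the chain rule. -/
def jacobianIter (κ : ℝ) (p : Torus) : ℕ → Matrix (Fin 2) (Fin 2) ℝ
  | 0 => 1
  | k + 1 => jacobian κ ((stdMap κ)^[k] p) * jacobianIter κ p k

/-- The expansion `α_{0,k}(p; κ) = (1 0) A^{(k)} (0 1)ᵀ`, that is `∂x_k/∂y_0`. -/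
def expansion (κ : ℝ) (k : ℕ) (p : Torus) : ℝ := jacobianIter κ p k 0 1

/-! ### Critical set, cyclicity, elliptic points -/

/-- The reference slope field `h₁(x, y) = φ̈(x) + 2/κ`, which depends on `x` only. -/
def slope₁ (κ : ℝ) (x : UnitAddCircle) : ℝ := ddphi x + 2 / κ

/-- The constant `τ = 80π` in the definition of the critical set. -/
def tau : ℝ := 80 * Real.pi

/-- The projected critical set with threshold `t`. -/
def projCrit (t κ : ℝ) : Set UnitAddCircle := {x | |slope₁ κ x| < t * κ ^ (-(1 / 2) : ℝ)}

/-- The critical set `C(κ)`. -/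
def criticalSet (κ : ℝ) : Set Torus := {p | p.1 ∈ projCrit tau κ}

/-- The (forward) orbit of `p`; for a periodic point it is the whole orbit. -/
def orbit (κ : ℝ) (p : Torus) : Set Torus := Set.range fun j : ℕ => (stdMap κ)^[j] p

/-- The cyclicity of the orbit of a periodic point: the number of its points in `C(κ)`. -/
def cyclicity (κ : ℝ) (p : Torus) : ℕ := (orbit κ p ∩ criticalSet κ).ncard

/-- `p` is an elliptic periodic point of least period `N` and cyclicity one: the differential of
`f_κ^N` at `p` (a matrix of determinant one) has two distinct non-real eigenvalues,
equivalently `|Tr d f_κ^N(p)| < 2`. -/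
def IsEllipticCyclicityOne (κ : ℝ) (N : ℕ) (p : Torus) : Prop :=
  0 < N ∧ Function.minimalPeriod (stdMap κ) p = N ∧ cyclicity κ p = 1 ∧
    (jacobianIter κ p N).IsElliptic

/-! ### Strips and rectangles -/

/-- The two kinds of vertical strips: critical (`c`) and dynamical (`d`). -/
inductive Kind where
  | c
  | d

/-- The projected strips. `proj c ±` is the closure of the component of the projected critical set
on which the sign of the third derivative of `φ` is `±`; `proj d ±` is the component of the
complement of the projected inner critical set (threshold `τ/10`) on which the sign of `h₁`
is `±`. Signs are the units of `ℤ`. -/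
def proj (κ : ℝ) : Kind → ℤˣ → Set UnitAddCircle
  | .c, s => closure {x | x ∈ projCrit tau κ ∧ 0 < ((s : ℤ) : ℝ) * dddphi x}
  | .d, s => {x | x ∉ projCrit (tau / 10) κ ∧ 0 < ((s : ℤ) : ℝ) * slope₁ κ x}

/-- The marked points `ξ_{c,-} = 0`, `ξ_{d,-} = 1/4`, `ξ_{c,+} = 1/2`, `ξ_{d,+} = 3/4`. -/
def center : Kind → ℤˣ → ℝ
  | .c, s => if s = 1 then 1 / 2 else 0
  | .d, s => if s = 1 then 3 / 4 else 1 / 4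

/-- A symbol of the basic alphabet: kind and sign of the strip visited one step before, sign of
the dynamical strip visited now, kind and sign of the strip visited one step after, and an
integer index. -/
structure Symbol where
  prevKind : Kind
  prevSign : ℤˣ
  sign : ℤˣ
  nextKind : Kind
  nextSign : ℤˣ
  index : ℤ

/-- The map `Ψ = (π ∘ f_κ⁻¹, π ∘ f_κ)`. -/
def psi (κ : ℝ) (p : Torus) : UnitAddCircle × UnitAddCircle :=
  (((stdMap κ).symm p).1, (stdMap κ p).1)

/-- The set `R` of the points that lie in the given dynamical strip, come from the given previous
strip and go to the given next strip. -/
def region (κ : ℝ) (a : Symbol) : Set Torus :=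
  {p | ((stdMap κ).symm p).1 ∈ proj κ a.prevKind a.prevSign ∧ p.1 ∈ proj κ .d a.sign ∧
    (stdMap κ p).1 ∈ proj κ a.nextKind a.nextSign}

/-- The points of the dynamical strip of sign `s` that come from the marked previous vertical line,
go to the marked next vertical line, and have index `k` (for given kinds and signs there is at most
one when `κ` is large). The index of `(x, y)` is
`s (κ φ̇(x) + 2 (x - ξ_{d,s})) + ξ_{next} - ξ_{prev}`, where `x` is represented in `[0, 1)`. For
given kinds and signs its values lie in a single coset of `ℤ`, which is `ℤ` or `ℤ + 1/2`; in the
latter case it is rounded down. -/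
def markedPoints (κ : ℝ) (a : Symbol) : Set Torus :=
  {p | ((stdMap κ).symm p).1 = (center a.prevKind a.prevSign : UnitAddCircle) ∧
    p.1 ∈ proj κ .d a.sign ∧
    (stdMap κ p).1 = (center a.nextKind a.nextSign : UnitAddCircle) ∧
    ∃ t ∈ Set.Ico (0 : ℝ) 1, (t : UnitAddCircle) = p.1 ∧
      ⌊((a.sign : ℤ) : ℝ) * (κ * dphi p.1 + 2 * (t - center .d a.sign)) +
        center a.nextKind a.nextSign - center a.prevKind a.prevSign⌋ = a.index}

/-- The component `R_a(κ)` of the region of `a` that contains the marked point of index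
`a.index`. -/
def rectangle (κ : ℝ) (a : Symbol) : Set Torus :=
  {p | ∃ q ∈ markedPoints κ a, p ∈ connectedComponentIn (region κ a) q}

/-- `a` is `κ`-admissible: `Ψ` is a diffeomorphism from `R_a(κ)` onto the product of its two bases.
`Ψ` is smooth and its Jacobian determinant `κ h₁` does not vanish on the region, which is compact,
so it is enough to require a bijection. -/
def Symbol.Admissible (κ : ℝ) (a : Symbol) : Prop :=
  Set.BijOn (psi κ) (rectangle κ a)
    (proj κ a.prevKind a.prevSign ×ˢ proj κ a.nextKind a.nextSign)

/-! ### Closed words and critical domains -/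

/-- Two boundary signs and a string of `r` symbols, `letter 0, …, letter (r - 1)`. -/
structure Word (r : ℕ) where
  left : ℤˣ
  letter : Fin r → Symbol
  right : ℤˣ

/-- Closed words: the previous strip is critical exactly for the first symbol, the next strip is
critical exactly for the last one, consecutive symbols are compatible, and so are the boundary
signs with the first and the last symbol. -/
structure Word.IsClosed {r : ℕ} (ω : Word r) : Prop where
  prevKind_iff : ∀ i : Fin r, (ω.letter i).prevKind = .c ↔ (i : ℕ) = 0
  nextKind_iff : ∀ i : Fin r, (ω.letter i).nextKind = .c ↔ (i : ℕ) + 1 = r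
  compatible : ∀ i j : Fin r, (j : ℕ) = i + 1 →
    (ω.letter i).sign = (ω.letter j).prevSign ∧ (ω.letter i).nextSign = (ω.letter j).sign
  left_compatible : ∀ i : Fin r, (i : ℕ) = 0 → ω.left = (ω.letter i).prevSign
  right_compatible : ∀ i : Fin r, (i : ℕ) + 1 = r → (ω.letter i).nextSign = ω.right

/-- The set of `κ`-admissible closed words of length `r`. -/
def closedWords (r : ℕ) (κ : ℝ) : Set (Word r) :=
  {ω | ω.IsClosed ∧ ∀ i, (ω.letter i).Admissible κ}

/-- The critical domain `Δ_ω(κ)` of a `κ`-admissible closed word `ω` of length `r`: the points `p`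
with `p` in the critical strip `ω.left`, `f_κ^{r+1}(p)` in the critical strip `ω.right`, and
`f_κ^l(p)` in the rectangle of the `l`-th symbol for `1 ≤ l ≤ r`. -/
def criticalDomain {r : ℕ} (ω : Word r) (κ : ℝ) : Set Torus :=
  {p | p.1 ∈ proj κ .c ω.left ∧ ((stdMap κ)^[r + 1] p).1 ∈ proj κ .c ω.right ∧
    ∀ i : Fin r, (stdMap κ)^[(i : ℕ) + 1] p ∈ rectangle κ (ω.letter i)}

/-! ### Parameter sets -/

/-- The left end point of the main parameter set. -/
def kappaA (n : ℕ) : ℝ := n / 2 - 7 / 16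

/-- The right end point of the main parameter set. -/
def kappaB (n : ℕ) : ℝ := n / 2 + 7 / 16

/-- The main parameter set `𝒦(n) = [κ_a(n), κ_b(n)]`. -/
def paramSet (n : ℕ) : Set ℝ := Set.Icc (kappaA n) (kappaB n)

/-- The admissibility set: the parameters of `𝒦(n)` for which `ω` is an admissible closed word. -/
def admissibleParams (n : ℕ) {r : ℕ} (ω : Word r) : Set ℝ :=
  {κ | κ ∈ paramSet n ∧ ω ∈ closedWords r κ}

/-- The minimal expansion `Λ_ω`: the infimum of `|α_{0,r+1}(p; κ)|` over all admissible parameters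
`κ ∈ 𝒦(n)` and all `p ∈ Δ_ω(κ)`. -/
def minExpansion (n : ℕ) {r : ℕ} (ω : Word r) : ℝ≥0∞ :=
  ⨅ κ ∈ admissibleParams n ω, ⨅ p ∈ criticalDomain ω κ, ‖expansion κ (r + 1) p‖ₑ

/-- `ℰ₁(N, ω)`: the admissible parameters of `𝒦(n)` for which `Δ_ω(κ)` contains an elliptic
`N`-periodic point of cyclicity one. -/
def ellipticParams (n N : ℕ) {r : ℕ} (ω : Word r) : Set ℝ :=
  {κ | κ ∈ admissibleParams n ω ∧ ∃ p ∈ criticalDomain ω κ, IsEllipticCyclicityOne κ N p}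

end StandardFamily

end

noncomputable section

namespace StandardFamily

/-! ### Trigonometric estimates -/

/-! A periodic point `p` of period `N` in the critical domain lifts to a real sequence `X 0, …, X N
= X 0` for which `2 X_l + κ cos(2πX_l) - X_{l-1} - X_{l+1}` is an integer at each time. At interior
times this integer is read off the symbol and does not depend on `κ` (`symbolForce_eq`). Only the
integer at the critical time 0 is free, and it takes boundedly many values (`abs_closing_add_le`).

Put `M = √κ_a`. At interior times the diagonal of the linearised problem has size at least `M`, so
by a discrete maximum principle the interior depends on `(X 0, κ)` with Lipschitz constant `O(1/M)`.
What remains is one scalar closing equation in `(X 0, κ)`. Its second derivative in `X 0` has size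
of order `κ` and sign `σ`, its derivative in `κ` is close to `-σ`, and its slope in `X 0` is the
defect `ε = (Tr df^N - 2)/α_{0N}`: a nondegenerate fold.

Ellipticity gives `-4 < α ε < 0`, and the sign of `α` is the product of the signs in the word
(`expansion_bounds`). Hence `|ε| ≤ 4/|α|`, and the word fixes the sign of `ε`.

For (a), two elliptic points with the same closing integer have `|D| = |X₂ 0 - X₁ 0|` at most
`O((|ε₁| + |ε₂| + |κ₂ - κ₁|)/κ)` (`abs_zero_sub_le`). Expanding the closing equation then bounds
`|κ₂ - κ₁|` by `O(|ε| |D| + κ D²) = O(1/(κ Λ²))` (`abs_param_sub_le_of_closing`), and summing over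
the closing integers costs a constant. For (b), two zeros of a strictly convex or concave function
have slopes of opposite sign, which the common sign of the defects excludes
(`eq_of_defect_mul_pos`). -/

/-- On a symmetric interval of half a period, a lower bound of the cosine passes to midpoints. -/
theorem le_cos_midpoint {m u v : ℝ} (hu : |u| ≤ Real.pi / 2) (hv : |v| ≤ Real.pi / 2)
    (hmu : m ≤ Real.cos u) (hmv : m ≤ Real.cos v) : m ≤ Real.cos ((u + v) / 2) := by
  have hpi := Real.pi_pos
  have key : ∀ w : ℝ, |w| ≤ Real.pi / 2 → |(u + v) / 2| ≤ |w| →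
      Real.cos w ≤ Real.cos ((u + v) / 2) := by
    intro w hw hle
    rw [← Real.cos_abs w, ← Real.cos_abs ((u + v) / 2)]
    exact Real.cos_le_cos_of_nonneg_of_le_pi (abs_nonneg _) (by linarith) hle
  have habs : |(u + v) / 2| ≤ (|u| + |v|) / 2 := by
    rw [abs_div, abs_two]
    have := abs_add_le u v
    linarith
  rcases le_total |u| |v| with h | h
  · exact hmv.trans (key v hv (by linarith))
  · exact hmu.trans (key u hu (by linarith))

theorem abs_sin_ge {x : ℝ} (hx : |x| ≤ 1 / 2) : 2 * |x| ≤ |Real.sin (Real.pi * x)| := by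
  have hpi := Real.pi_pos
  have h := Real.mul_le_sin (x := Real.pi * |x|) (by positivity) (by nlinarith)
  have h2 : 2 / Real.pi * (Real.pi * |x|) = 2 * |x| := by field_simp
  rw [h2] at h
  rcases abs_cases x with ⟨hx1, -⟩ | ⟨hx1, -⟩
  · rw [hx1] at h ⊢
    exact h.trans (le_abs_self _)
  · rw [hx1] at h ⊢
    refine h.trans ?_
    rw [mul_neg (Real.pi), Real.sin_neg]
    exact neg_le_abs _

/-- First order Taylor estimate for `t ↦ cos (2πt)`. -/
theorem abs_cos_taylor_le (a b : ℝ) :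
    |Real.cos (2 * Real.pi * a) - Real.cos (2 * Real.pi * b) -
      2 * Real.pi * Real.sin (2 * Real.pi * b) * (b - a)| ≤ 120 * (b - a) ^ 2 := by
  set h : ℝ := 2 * Real.pi * (a - b) with hh
  have hpi4 : Real.pi < 3.15 := Real.pi_lt_d2
  have hpi := Real.pi_pos
  have e : 2 * Real.pi * a = 2 * Real.pi * b + h := by rw [hh]; ring
  have e2 : Real.cos (2 * Real.pi * a) - Real.cos (2 * Real.pi * b) -
      2 * Real.pi * Real.sin (2 * Real.pi * b) * (b - a) =
      Real.cos (2 * Real.pi * b) * (Real.cos h - 1) +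
        Real.sin (2 * Real.pi * b) * (h - Real.sin h) := by
    rw [e, Real.cos_add, hh]; ring
  have h1 : |Real.cos h - 1| ≤ h ^ 2 / 2 := by
    rw [abs_le]
    constructor
    · linarith [Real.one_sub_sq_div_two_le_cos (x := h)]
    · linarith [Real.cos_le_one h, sq_nonneg h]
  have h2 : |h - Real.sin h| ≤ 2 * h ^ 2 := by
    rcases le_total 1 |h| with hc | hc
    · calc |h - Real.sin h| ≤ |h| + |Real.sin h| := abs_sub _ _
        _ ≤ |h| + |h| := by linarith [Real.abs_sin_le_abs (x := h)]
        _ ≤ 2 * h ^ 2 := by rw [← sq_abs h]; nlinarith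
    · have key : ∀ x : ℝ, 0 ≤ x → x ≤ 1 → |x - Real.sin x| ≤ 2 * x ^ 2 := by
        intro x hx0 hx1
        rcases hx0.eq_or_lt with rfl | hx0
        · simp
        rw [abs_of_nonneg (by linarith [Real.sin_lt hx0])]
        have := Real.sin_gt_sub_cube hx0
        nlinarith [mul_pos hx0 hx0]
      rcases abs_cases h with ⟨he, -⟩ | ⟨he, hneg⟩
      · exact key h (by rw [← he]; exact abs_nonneg _) (by rw [← he]; exact hc)
      · have := key (-h) (by linarith) (by rw [← he]; exact hc)
        rw [Real.sin_neg, neg_sq, ← abs_neg] at this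
        convert this using 2
        ring
  rw [e2]
  have hcb := Real.abs_cos_le_one (2 * Real.pi * b)
  have hsb := Real.abs_sin_le_one (2 * Real.pi * b)
  calc _ ≤ |Real.cos (2 * Real.pi * b)| * |Real.cos h - 1| +
        |Real.sin (2 * Real.pi * b)| * |h - Real.sin h| := by
        rw [← abs_mul, ← abs_mul]; exact abs_add_le _ _
    _ ≤ 1 * (h ^ 2 / 2) + 1 * (2 * h ^ 2) := by gcongr
    -- The two bounds add up to `(5/2) h²` with `h² = 4π² (b - a)²`, and `π² ≤ 10`.
    _ ≤ 120 * (b - a) ^ 2 := by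
        rw [hh]
        have : Real.pi ^ 2 ≤ 10 := by nlinarith
        nlinarith [sq_nonneg (b - a)]

/-- Near its extrema the cosine lies on the strictly concave side of its tangents. -/
theorem cos_tangent_gap {s a b : ℝ} (hs : s = 1 ∨ s = -1) (hab : |b - a| ≤ 1 / 2)
    (hc : 9 / 10 ≤ -s * Real.cos (2 * Real.pi * b))
    (hsin : |Real.sin (2 * Real.pi * b)| ≤ 1 / 1000) :
    2 * (b - a) ^ 2 ≤ s * (Real.cos (2 * Real.pi * a) - Real.cos (2 * Real.pi * b) -
      2 * Real.pi * Real.sin (2 * Real.pi * b) * (b - a)) := by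
  set h : ℝ := 2 * Real.pi * (a - b) with hh
  have hpi4 : Real.pi < 3.15 := Real.pi_lt_d2
  have hpi3 : 3.14 < Real.pi := Real.pi_gt_d2
  have hpi := Real.pi_pos
  have e : 2 * Real.pi * a = 2 * Real.pi * b + h := by rw [hh]; ring
  have e2 : s * (Real.cos (2 * Real.pi * a) - Real.cos (2 * Real.pi * b) -
      2 * Real.pi * Real.sin (2 * Real.pi * b) * (b - a)) =
      (-s * Real.cos (2 * Real.pi * b)) * (1 - Real.cos h) +
        s * Real.sin (2 * Real.pi * b) * (h - Real.sin h) := by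
    rw [e, Real.cos_add, hh]; ring
  have hhle : |h| ≤ Real.pi := by
    rw [hh, abs_mul, abs_of_pos (by positivity), abs_sub_comm]
    nlinarith
  have h1 : 2 / Real.pi ^ 2 * h ^ 2 ≤ 1 - Real.cos h := by
    linarith [Real.cos_le_one_sub_mul_cos_sq hhle]
  have h1' : 2 / Real.pi ^ 2 * h ^ 2 = 8 * (b - a) ^ 2 := by
    rw [hh]; field_simp; ring
  -- This is `abs_cos_taylor_le` at a quarter period, where the cosine becomes a sine.
  have h2 : |h - Real.sin h| ≤ 160 * (b - a) ^ 2 := by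
    have := abs_cos_taylor_le (1 / 4 + (b - a)) (1 / 4)
    have e3 : 2 * Real.pi * (1 / 4 + (b - a)) = Real.pi / 2 - h := by rw [hh]; ring
    have e4 : 2 * Real.pi * (1 / 4) = Real.pi / 2 := by ring
    rw [e3, e4, Real.cos_pi_div_two_sub, Real.cos_pi_div_two, Real.sin_pi_div_two] at this
    rw [abs_sub_comm]
    have e5 : Real.sin h - 0 - 2 * Real.pi * 1 * (1 / 4 - (1 / 4 + (b - a))) =
      Real.sin h - h := by rw [hh]; ring
    rw [e5] at this
    nlinarith [sq_nonneg (b - a)]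
  have habss : |s| = 1 := by rcases hs with rfl | rfl <;> simp
  have h3 : |s * Real.sin (2 * Real.pi * b) * (h - Real.sin h)| ≤
      1 / 1000 * (160 * (b - a) ^ 2) := by
    rw [abs_mul, abs_mul, habss, one_mul]
    gcongr
  have h4 := (abs_le.1 h3).1
  have h5 : 9 / 10 * (8 * (b - a) ^ 2) ≤
      -- The quadratic gain `7.2 (b - a)²` exceeds the loss `0.16 (b - a)²` from the sine term.
      (-s * Real.cos (2 * Real.pi * b)) * (1 - Real.cos h) := by
    rw [h1'] at h1
    have : (0:ℝ) ≤ 8 * (b - a) ^ 2 := by positivity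
    gcongr
  rw [e2]
  nlinarith [sq_nonneg (b - a)]

/-! ### Diagonally dominant tridiagonal systems -/

/-- A discrete maximum principle for strongly diagonally dominant tridiagonal systems. -/
theorem tridiagonal_bound {M B R : ℝ} (hM : 4 ≤ M) (hB : 0 ≤ B) {N : ℕ}
    {w : ℕ → ℝ} (h0 : |w 0| ≤ B) (hN : |w N| ≤ B)
    (h : ∀ l, l + 1 < N → M * |w (l + 1)| ≤ |w l| + |w (l + 2)| + R) :
    ∀ l, l + 1 < N → |w (l + 1)| ≤ (4 * B + 2 * R) / M := by
  intro l hl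
  -- At an index where the interior maximum `S` is attained the row reads `M S ≤ 2 (S + B) + R`;
  -- since `M ≥ 4`, the term `2 S` is at most half of the left side.
  obtain ⟨j, hj, hmax⟩ := Finset.exists_max_image (Finset.range (N - 1)) (fun i => |w (i + 1)|)
    ⟨l, Finset.mem_range.2 (by omega)⟩
  rw [Finset.mem_range] at hj
  set S := |w (j + 1)| with hS
  have hSnn : 0 ≤ S := abs_nonneg _
  have hle : ∀ i, i ≤ N → |w i| ≤ S + B := by
    intro i hi
    rcases Nat.eq_zero_or_pos i with rfl | hi0
    · linarith
    rcases hi.eq_or_lt with rfl | hi1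
    · linarith
    obtain ⟨k, rfl⟩ : ∃ k, i = k + 1 := ⟨i - 1, by omega⟩
    have := hmax k (Finset.mem_range.2 (by omega))
    linarith
  have h1 := h j (by omega)
  have h2 := hle j (by omega)
  have h3 := hle (j + 2) (by omega)
  have hlS : |w (l + 1)| ≤ S := hmax l (Finset.mem_range.2 (by omega))
  refine hlS.trans ?_
  rw [le_div_iff₀ (by linarith)]
  nlinarith

theorem tridiagonal_bound_of_zero {M R : ℝ} (hM : 4 ≤ M) (hR : 0 ≤ R) {N : ℕ}
    {w : ℕ → ℝ} (h0 : w 0 = 0) (hN : w N = 0)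
    (h : ∀ l, l + 1 < N → M * |w (l + 1)| ≤ |w l| + |w (l + 2)| + R) :
    ∀ l, l ≤ N → |w l| ≤ 2 * R / M := by
  intro l hl
  rcases Nat.eq_zero_or_pos l with rfl | hl0
  · rw [h0, abs_zero]; positivity
  rcases hl.eq_or_lt with rfl | hl1
  · rw [hN, abs_zero]; positivity
  obtain ⟨k, rfl⟩ : ∃ k, l = k + 1 := ⟨l - 1, by omega⟩
  have := tridiagonal_bound hM le_rfl (w := w) (by rw [h0, abs_zero]) (by rw [hN, abs_zero]) h k hl1
  rwa [mul_zero, zero_add] at this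

/-! ### Comparison of two periodic chains -/

/-- A lifted periodic orbit `X` at the parameter `κ` with its linearised periodic problem: `u` solves
the linearised equation in the interior with boundary values one, and `ε` is its defect at the
end point. The point `X 0` lies in the critical strip of sign `σ`, the point `X l` with
`0 < l < N` in the dynamical strip of sign `s l`. -/
structure PeriodicChain (M κ : ℝ) (N : ℕ) (σ : ℤˣ) (s : ℕ → ℤˣ) (X u : ℕ → ℝ) (ε : ℝ) : Prop where
  -- `M` stands for `√κ_a`; the parameter interval has length `7/8 < 1`.
  le_param : M ^ 2 ≤ κ
  param_le : κ ≤ M ^ 2 + 1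
  closed : X N = X 0
  near_zero : |X 0 - center .c σ| ≤ 1 / 4
  cos_zero : 9 / 10 ≤ -((σ : ℤ) : ℝ) * Real.cos (2 * Real.pi * X 0)
  sin_zero : |Real.sin (2 * Real.pi * X 0)| ≤ 41 / M
  near : ∀ l, l + 1 < N → |X (l + 1) - center .d (s (l + 1))| ≤ 1 / 4
  sin_ge : ∀ l, l + 1 < N →
    1 / M ≤ -((s (l + 1) : ℤ) : ℝ) * Real.sin (2 * Real.pi * X (l + 1))
  lin_zero : u 0 = 1
  lin_last : u N = 1
  linear : ∀ l, l + 1 < N →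
    (2 - κ * (2 * Real.pi * Real.sin (2 * Real.pi * X (l + 1)))) * u (l + 1) = u l + u (l + 2)
  defect : ε = (2 - κ * (2 * Real.pi * Real.sin (2 * Real.pi * X 0))) - u 1 - u (N - 1)

/-- The value of the discrete Euler–Lagrange operator at three consecutive points. -/
def stdForce (κ x y z : ℝ) : ℝ := 2 * y + κ * Real.cos (2 * Real.pi * y) - x - z

/-! ### Expansion in dynamical strips and monotonicity in critical strips -/

theorem cos_center_c (s : ℤˣ) (x : ℝ) :
    Real.cos (2 * Real.pi * (x - center .c s)) = -((s : ℤ) : ℝ) * Real.cos (2 * Real.pi * x) := by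
  rcases Int.units_eq_one_or s with rfl | rfl
  · have : 2 * Real.pi * (x - center .c 1) = 2 * Real.pi * x - Real.pi := by simp [center]; ring
    rw [this, Real.cos_sub_pi]; simp
  · have : 2 * Real.pi * (x - center .c (-1)) = 2 * Real.pi * x := by
      simp [center, show (-1 : ℤˣ) ≠ 1 by decide]
    rw [this]; simp

theorem cos_center_d (s : ℤˣ) (x : ℝ) :
    Real.cos (2 * Real.pi * (x - center .d s)) = -((s : ℤ) : ℝ) * Real.sin (2 * Real.pi * x) := by
  rcases Int.units_eq_one_or s with rfl | rfl
  · have : 2 * Real.pi * (x - center .d 1) = 2 * Real.pi * x - Real.pi / 2 - Real.pi := by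
      simp [center]; ring
    rw [this, Real.cos_sub_pi, Real.cos_sub_pi_div_two]; simp
  · have : 2 * Real.pi * (x - center .d (-1)) = 2 * Real.pi * x - Real.pi / 2 := by
      simp [center, show (-1 : ℤˣ) ≠ 1 by decide]; ring
    rw [this, Real.cos_sub_pi_div_two]; simp

theorem units_cast_cases (s : ℤˣ) : ((s : ℤ) : ℝ) = 1 ∨ ((s : ℤ) : ℝ) = -1 := by
  rcases Int.units_eq_one_or s with rfl | rfl <;> simp

theorem abs_units_cast (s : ℤˣ) : |((s : ℤ) : ℝ)| = 1 := by
  rcases units_cast_cases s with h | h <;> simp [h]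

/-- If the cosine relative to a center is at least `m` at two points at distance at most `1/4` from
the center, it is at least `m` at their midpoint. -/
theorem le_cos_midpoint_center {m c a b : ℝ} (ha : |a - c| ≤ 1 / 4) (hb : |b - c| ≤ 1 / 4)
    (hma : m ≤ Real.cos (2 * Real.pi * (a - c))) (hmb : m ≤ Real.cos (2 * Real.pi * (b - c))) :
    m ≤ Real.cos (2 * Real.pi * ((a + b) / 2 - c)) := by
  have hpi := Real.pi_pos
  have e : 2 * Real.pi * ((a + b) / 2 - c) =
      (2 * Real.pi * (a - c) + 2 * Real.pi * (b - c)) / 2 := by ring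
  rw [e]
  refine le_cos_midpoint ?_ ?_ hma hmb <;>
  · rw [abs_mul, abs_of_pos (by positivity)]
    nlinarith

theorem abs_sub_le_half {a b c : ℝ} (ha : |a - c| ≤ 1 / 4) (hb : |b - c| ≤ 1 / 4) :
    |b - a| ≤ 1 / 2 := by
  have := abs_sub_le b c a
  rw [abs_sub_comm c a] at this
  linarith

/-- Expansion of the Euler–Lagrange operator in a dynamical strip. -/
theorem expanding_of_dynamical {M κ a b : ℝ} {s : ℤˣ} (hM : 1 ≤ M) (hκ : M ^ 2 ≤ κ)
    (ha : |a - center .d s| ≤ 1 / 4) (hb : |b - center .d s| ≤ 1 / 4)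
    (hsa : 1 / M ≤ -((s : ℤ) : ℝ) * Real.sin (2 * Real.pi * a))
    (hsb : 1 / M ≤ -((s : ℤ) : ℝ) * Real.sin (2 * Real.pi * b)) :
    M * |b - a| ≤
      |2 * (b - a) + κ * (Real.cos (2 * Real.pi * b) - Real.cos (2 * Real.pi * a))| := by
  have hmid := le_cos_midpoint_center (m := 1 / M) ha hb (by rwa [cos_center_d])
    (by rwa [cos_center_d])
  rw [cos_center_d] at hmid
  -- The product formula reduces the difference to the sine at the midpoint, which obeys the same
  -- lower bound as at the end points. This gives the factor `4 M`, and the linear term takes away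
  -- at most `2`.
  have e : Real.cos (2 * Real.pi * b) - Real.cos (2 * Real.pi * a) =
      -2 * Real.sin (2 * Real.pi * ((a + b) / 2)) * Real.sin (Real.pi * (b - a)) := by
    rw [Real.cos_sub_cos]
    congr 2
    · congr 2; ring
    · ring
  have hsin := abs_sin_ge (abs_sub_le_half ha hb)
  have hm : 1 / M ≤ |Real.sin (2 * Real.pi * ((a + b) / 2))| := by
    refine hmid.trans ((le_abs_self _).trans ?_)
    rw [abs_mul, abs_neg, abs_units_cast, one_mul]
  have hMpos : 0 < M := by linarith
  have hκ0 : 0 < κ := lt_of_lt_of_le (by positivity) hκ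
  have h1 : 4 * M * |b - a| ≤
      |κ * (Real.cos (2 * Real.pi * b) - Real.cos (2 * Real.pi * a))| := by
    rw [e, abs_mul, abs_mul, abs_mul, abs_of_pos hκ0]
    calc 4 * M * |b - a| = M ^ 2 * (2 * (1 / M) * (2 * |b - a|)) := by field_simp; ring
      _ ≤ κ * (|(-2 : ℝ)| * |Real.sin (2 * Real.pi * ((a + b) / 2))| *
          |Real.sin (Real.pi * (b - a))|) := by
        have : |(-2 : ℝ)| = 2 := by norm_num
        rw [this]
        gcongr
  have h2 : |κ * (Real.cos (2 * Real.pi * b) - Real.cos (2 * Real.pi * a))| ≤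
      |2 * (b - a) + κ * (Real.cos (2 * Real.pi * b) - Real.cos (2 * Real.pi * a))| +
        2 * |b - a| := by
    have := abs_sub (2 * (b - a) + κ * (Real.cos (2 * Real.pi * b) - Real.cos (2 * Real.pi * a)))
      (2 * (b - a))
    rw [add_sub_cancel_left, abs_mul 2, abs_two] at this
    exact this
  nlinarith [abs_nonneg (b - a)]

/-- As `κ/M ≥ M` and `2π > 6`, the sine term is at least `6 M` and absorbs the `2`. The sign is kept
because it later determines the sign of the expansion. -/
theorem le_abs_diag {M κ a : ℝ} {s : ℤˣ} (hM : 1 ≤ M) (hκ : M ^ 2 ≤ κ)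
    (hsa : 1 / M ≤ -((s : ℤ) : ℝ) * Real.sin (2 * Real.pi * a)) :
    M ≤ ((s : ℤ) : ℝ) * (2 - κ * (2 * Real.pi * Real.sin (2 * Real.pi * a))) := by
  have hpi : 3 < Real.pi := Real.pi_gt_three
  have hMpos : 0 < M := by linarith
  have hκ0 : 0 ≤ κ := le_trans (by positivity) hκ
  have h1 : M ^ 2 * (2 * 3 * (1 / M)) ≤
      κ * (2 * Real.pi * (-((s : ℤ) : ℝ) * Real.sin (2 * Real.pi * a))) := by
    gcongr
  have h2 : M ^ 2 * (2 * 3 * (1 / M)) = 6 * M := by field_simp; ring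
  rcases units_cast_cases s with h | h <;> rw [h] at h1 ⊢ <;> nlinarith

/-- In a critical strip the derivative of the Euler–Lagrange operator is strictly monotone. -/
theorem sin_sub_sin_of_critical {a b : ℝ} {s : ℤˣ}
    (ha : |a - center .c s| ≤ 1 / 4) (hb : |b - center .c s| ≤ 1 / 4)
    (hsa : 9 / 10 ≤ -((s : ℤ) : ℝ) * Real.cos (2 * Real.pi * a))
    (hsb : 9 / 10 ≤ -((s : ℤ) : ℝ) * Real.cos (2 * Real.pi * b)) :
    3 * |b - a| ≤ |Real.sin (2 * Real.pi * b) - Real.sin (2 * Real.pi * a)| := by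
  have hmid := le_cos_midpoint_center (m := 9 / 10) ha hb (by rwa [cos_center_c])
    (by rwa [cos_center_c])
  rw [cos_center_c] at hmid
  have e : Real.sin (2 * Real.pi * b) - Real.sin (2 * Real.pi * a) =
      2 * Real.sin (Real.pi * (b - a)) * Real.cos (2 * Real.pi * ((a + b) / 2)) := by
    rw [Real.sin_sub_sin]
    congr 2
    · congr 2; ring
    · ring
  have hsin := abs_sin_ge (abs_sub_le_half ha hb)
  have hm : 9 / 10 ≤ |Real.cos (2 * Real.pi * ((a + b) / 2))| := by
    refine hmid.trans ((le_abs_self _).trans ?_)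
    rw [abs_mul, abs_neg, abs_units_cast, one_mul]
  rw [e, abs_mul, abs_mul, abs_two]
  nlinarith [abs_nonneg (b - a), abs_nonneg (Real.sin (Real.pi * (b - a)))]

theorem abs_sin_sub_sin_le (a b : ℝ) :
    |Real.sin (2 * Real.pi * b) - Real.sin (2 * Real.pi * a)| ≤ 7 * |b - a| := by
  have hpi : Real.pi < 3.15 := Real.pi_lt_d2
  have h := Real.abs_sin_sub_sin_le (2 * Real.pi * b) (2 * Real.pi * a)
  rw [← mul_sub, abs_mul, abs_of_pos (by positivity : 0 < 2 * Real.pi)] at h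
  nlinarith [abs_nonneg (b - a)]

/-! ### Dependence of a chain on its critical coordinate and on the parameter -/

namespace PeriodicChain

variable {M κ₁ κ₂ : ℝ} {N : ℕ} {σ : ℤˣ} {s : ℕ → ℤˣ} {X₁ X₂ u₁ u₂ : ℕ → ℝ} {ε₁ ε₂ : ℝ}

theorem abs_param_sub_le (h₁ : PeriodicChain M κ₁ N σ s X₁ u₁ ε₁)
    (h₂ : PeriodicChain M κ₂ N σ s X₂ u₂ ε₂) : |κ₂ - κ₁| ≤ 1 := by
  rw [abs_le]
  constructor <;> linarith [h₁.le_param, h₂.le_param, h₁.param_le, h₂.param_le]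

theorem le_abs_diag (hM : 1 ≤ M) (h₁ : PeriodicChain M κ₁ N σ s X₁ u₁ ε₁) {l : ℕ}
    (hl : l + 1 < N) :
    M ≤ |2 - κ₁ * (2 * Real.pi * Real.sin (2 * Real.pi * X₁ (l + 1)))| := by
  refine (StandardFamily.le_abs_diag hM h₁.le_param (h₁.sin_ge l hl)).trans
    ((le_abs_self _).trans ?_)
  rw [abs_mul, abs_units_cast, one_mul]

/-- Subtracting the interior equations leaves an expanding diagonal term, the neighbouring
displacements and a source of size `|κ₂ - κ₁|`. The maximum principle then shows that the interior
is slaved to the critical coordinate and the parameter. -/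
theorem displacement_le (hM : 1000000 ≤ M) (h₁ : PeriodicChain M κ₁ N σ s X₁ u₁ ε₁)
    (h₂ : PeriodicChain M κ₂ N σ s X₂ u₂ ε₂)
    (heq : ∀ l, l + 1 < N → stdForce κ₂ (X₂ l) (X₂ (l + 1)) (X₂ (l + 2)) =
      stdForce κ₁ (X₁ l) (X₁ (l + 1)) (X₁ (l + 2))) :
    ∀ l, l + 1 < N → |X₂ (l + 1) - X₁ (l + 1)| ≤ 4 * (|X₂ 0 - X₁ 0| + |κ₂ - κ₁|) / M := by
  intro l hl
  have hb := tridiagonal_bound (M := M) (B := |X₂ 0 - X₁ 0|) (R := |κ₂ - κ₁|)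
    (by linarith) (abs_nonneg _) (N := N) (w := fun l => X₂ l - X₁ l) le_rfl
    (by simp only [h₁.closed, h₂.closed]; exact le_rfl) ?_ l hl
  · refine hb.trans ?_
    have hMpos : 0 < M := by linarith
    gcongr
    linarith [abs_nonneg (κ₂ - κ₁)]
  · intro l hl
    have h := expanding_of_dynamical (by linarith) h₂.le_param (h₁.near l hl) (h₂.near l hl)
      (h₁.sin_ge l hl) (h₂.sin_ge l hl)
    refine h.trans ?_
    have e : 2 * (X₂ (l + 1) - X₁ (l + 1)) + κ₂ * (Real.cos (2 * Real.pi * X₂ (l + 1)) -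
        Real.cos (2 * Real.pi * X₁ (l + 1))) = (X₂ l - X₁ l) + (X₂ (l + 2) - X₁ (l + 2)) -
        (κ₂ - κ₁) * Real.cos (2 * Real.pi * X₁ (l + 1)) := by
      have := heq l hl
      simp only [stdForce] at this
      linarith
    rw [e]
    refine (abs_sub _ _).trans (add_le_add (abs_add_le _ _) ?_)
    rw [abs_mul]
    exact mul_le_of_le_one_right (abs_nonneg _) (Real.abs_cos_le_one _)

/-- The boundary values one are damped by a factor `O(1/M)` as soon as they enter the interior. -/
theorem abs_lin_le (hM : 1000000 ≤ M) (h₁ : PeriodicChain M κ₁ N σ s X₁ u₁ ε₁) :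
    ∀ l, l + 1 < N → |u₁ (l + 1)| ≤ 4 / M := by
  intro l hl
  have hb := tridiagonal_bound (M := M) (B := 1) (R := 0) (by linarith) zero_le_one (N := N)
    (w := u₁) (by simp [h₁.lin_zero]) (by simp [h₁.lin_last]) ?_ l hl
  · simpa using hb
  · intro l hl
    have h := h₁.le_abs_diag (by linarith) hl
    rw [add_zero]
    refine le_trans ?_ (abs_add_le _ _)
    rw [← h₁.linear l hl, abs_mul]
    gcongr

theorem abs_diag_sub_le (h₂ : PeriodicChain M κ₂ N σ s X₂ u₂ ε₂) (a b : ℝ) :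
    |(2 - κ₂ * (2 * Real.pi * Real.sin (2 * Real.pi * b))) -
      (2 - κ₁ * (2 * Real.pi * Real.sin (2 * Real.pi * a)))| ≤
      49 * (M ^ 2 + 1) * |b - a| + 7 * |κ₂ - κ₁| := by
  have hpi : Real.pi < 3.15 := Real.pi_lt_d2
  have hpi0 := Real.pi_pos
  have hκ₂ : 0 ≤ κ₂ := le_trans (by positivity) h₂.le_param
  have e : (2 - κ₂ * (2 * Real.pi * Real.sin (2 * Real.pi * b))) -
      (2 - κ₁ * (2 * Real.pi * Real.sin (2 * Real.pi * a))) =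
      -(2 * Real.pi * (κ₂ * (Real.sin (2 * Real.pi * b) - Real.sin (2 * Real.pi * a)) +
        (κ₂ - κ₁) * Real.sin (2 * Real.pi * a))) := by ring
  rw [e, abs_neg, abs_mul, abs_of_pos (by positivity : 0 < 2 * Real.pi)]
  calc _ ≤ 7 * ((M ^ 2 + 1) * (7 * |b - a|) + |κ₂ - κ₁| * 1) := by
        gcongr
        · linarith
        · refine (abs_add_le _ _).trans ?_
          rw [abs_mul, abs_mul, abs_of_nonneg hκ₂]
          gcongr
          · exact h₂.param_le
          · exact abs_sin_sub_sin_le a b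
          · exact Real.abs_sin_le_one _
    _ = _ := by ring

/-- The difference solves the linear system of the second chain with source `(d₂ - d₁) u₁`.
Displacements of order `E/M` change the diagonal by `O(M E)`, and `u₁ = O(1/M)`, so the source is
`O(E)`; inverting the system gains another `1/M`. -/
theorem abs_lin_sub_le (hM : 1000000 ≤ M) (h₁ : PeriodicChain M κ₁ N σ s X₁ u₁ ε₁)
    (h₂ : PeriodicChain M κ₂ N σ s X₂ u₂ ε₂)
    (heq : ∀ l, l + 1 < N → stdForce κ₂ (X₂ l) (X₂ (l + 1)) (X₂ (l + 2)) =
      stdForce κ₁ (X₁ l) (X₁ (l + 1)) (X₁ (l + 2))) :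
    ∀ l, l ≤ N → |u₂ l - u₁ l| ≤ 1600 * (|X₂ 0 - X₁ 0| + |κ₂ - κ₁|) / M := by
  intro l hl
  set E := |X₂ 0 - X₁ 0| + |κ₂ - κ₁| with hE
  have hE0 : 0 ≤ E := by positivity
  have hMpos : 0 < M := by linarith
  have hb := tridiagonal_bound_of_zero (M := M) (R := 800 * E)
    (by linarith) (by positivity) (N := N) (w := fun l => u₂ l - u₁ l)
    (by simp [h₁.lin_zero, h₂.lin_zero]) (by simp [h₁.lin_last, h₂.lin_last]) ?_ l hl
  · refine hb.trans (le_of_eq ?_)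
    ring
  · intro l hl
    set d₁ := 2 - κ₁ * (2 * Real.pi * Real.sin (2 * Real.pi * X₁ (l + 1))) with hd₁
    set d₂ := 2 - κ₂ * (2 * Real.pi * Real.sin (2 * Real.pi * X₂ (l + 1))) with hd₂
    have h := h₂.le_abs_diag (by linarith) hl
    have hl1 := h₁.linear l hl
    have hl2 := h₂.linear l hl
    rw [← hd₁] at hl1
    rw [← hd₂] at hl2 h
    have e : d₂ * (u₂ (l + 1) - u₁ (l + 1)) = (u₂ l - u₁ l) + (u₂ (l + 2) - u₁ (l + 2)) -
        (d₂ - d₁) * u₁ (l + 1) := by linarith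
    have hdd := abs_diag_sub_le (κ₁ := κ₁) h₂ (X₁ (l + 1)) (X₂ (l + 1))
    rw [← hd₁, ← hd₂] at hdd
    have hdis := displacement_le hM h₁ h₂ heq l hl
    rw [← hE] at hdis
    have hδ : |κ₂ - κ₁| ≤ E := by rw [hE]; linarith [abs_nonneg (X₂ 0 - X₁ 0)]
    have hR : |(d₂ - d₁) * u₁ (l + 1)| ≤ 800 * E := by
      rw [abs_mul]
      calc |d₂ - d₁| * |u₁ (l + 1)|
          ≤ (49 * (M ^ 2 + 1) * (4 * E / M) + 7 * E) * (4 / M) := by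
            have := abs_lin_le hM h₁ l hl
            gcongr
            exact hdd.trans (by gcongr)
        _ = (784 + 784 / M ^ 2 + 28 / M) * E := by field_simp; ring
        _ ≤ 800 * E := by
            gcongr
            have : 784 / M ^ 2 ≤ 1 := by rw [div_le_one (by positivity)]; nlinarith
            have : 28 / M ≤ 1 := by rw [div_le_one (by positivity)]; linarith
            linarith
    calc M * |u₂ (l + 1) - u₁ (l + 1)| ≤ |d₂ * (u₂ (l + 1) - u₁ (l + 1))| := by
          rw [abs_mul]; gcongr
      _ ≤ |u₂ l - u₁ l| + |u₂ (l + 2) - u₁ (l + 2)| + |(d₂ - d₁) * u₁ (l + 1)| := by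
          rw [e]
          exact (abs_sub _ _).trans (add_le_add (abs_add_le _ _) le_rfl)
      _ ≤ _ := by linarith

/-- The critical coordinates of two chains are as close as their defects and parameters allow. -/
theorem abs_zero_sub_le (hM : 1000000 ≤ M) (hN : 1 ≤ N)
    (h₁ : PeriodicChain M κ₁ N σ s X₁ u₁ ε₁)
    (h₂ : PeriodicChain M κ₂ N σ s X₂ u₂ ε₂)
    (heq : ∀ l, l + 1 < N → stdForce κ₂ (X₂ l) (X₂ (l + 1)) (X₂ (l + 2)) =
      stdForce κ₁ (X₁ l) (X₁ (l + 1)) (X₁ (l + 2))) :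
    17 * M ^ 2 * |X₂ 0 - X₁ 0| ≤ |ε₁| + |ε₂| + |κ₂ - κ₁| := by
  have hMpos : 0 < M := by linarith
  have hpi : Real.pi < 3.15 := Real.pi_lt_d2
  have hpi3 : 3 < Real.pi := Real.pi_gt_three
  have hκ₂ : 0 ≤ κ₂ := le_trans (by positivity) h₂.le_param
  have hV1 := abs_lin_sub_le hM h₁ h₂ heq 1 hN
  have hV2 := abs_lin_sub_le hM h₁ h₂ heq (N - 1) (by omega)
  have hs := sin_sub_sin_of_critical h₁.near_zero h₂.near_zero h₁.cos_zero h₂.cos_zero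
  have hs1 := h₁.sin_zero
  set D := |X₂ 0 - X₁ 0| with hD
  set δ := κ₂ - κ₁ with hδ
  set V₁ := u₂ 1 - u₁ 1 with hV₁
  set V₂ := u₂ (N - 1) - u₁ (N - 1) with hV₂
  set S₁ := Real.sin (2 * Real.pi * X₁ 0) with hS₁
  set S₂ := Real.sin (2 * Real.pi * X₂ 0) with hS₂
  have hD0 : 0 ≤ D := abs_nonneg _
  -- Subtracting the defects isolates the change of the sine at the critical point, which controls
  -- `D` by monotonicity. The constant 18 drops to 17 when the `D` part of the `V` terms is
  -- absorbed.
  have e : κ₂ * (2 * Real.pi * (S₂ - S₁)) = ε₁ - ε₂ - δ * (2 * Real.pi * S₁) - V₁ - V₂ := by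
    rw [h₁.defect, h₂.defect, hV₁, hV₂, hδ]; ring
  have h1 : 18 * M ^ 2 * D ≤ |κ₂ * (2 * Real.pi * (S₂ - S₁))| := by
    rw [abs_mul, abs_mul, abs_of_nonneg hκ₂, abs_of_pos (by positivity : 0 < 2 * Real.pi)]
    calc 18 * M ^ 2 * D = M ^ 2 * (2 * 3 * (3 * D)) := by ring
      _ ≤ _ := by
        have := h₂.le_param
        gcongr
  have h2 : |δ * (2 * Real.pi * S₁)| ≤ 1 / 4 * |δ| := by
    rw [abs_mul, abs_mul, abs_of_pos (by positivity : 0 < 2 * Real.pi), mul_comm]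
    gcongr
    calc 2 * Real.pi * |S₁| ≤ 7 * (41 / M) := by gcongr; linarith
      _ ≤ 1 / 4 := by rw [← mul_div_assoc, div_le_iff₀ hMpos]; linarith
  have h3 : 1600 * (D + |δ|) / M ≤ 1 / 4 * (D + |δ|) := by
    rw [div_le_iff₀ hMpos]
    nlinarith [abs_nonneg δ]
  have h4 : |κ₂ * (2 * Real.pi * (S₂ - S₁))| ≤
      |ε₁| + |ε₂| + |δ * (2 * Real.pi * S₁)| + |V₁| + |V₂| := by
    rw [e]
    refine (abs_sub _ _).trans (add_le_add ((abs_sub _ _).trans (add_le_add ((abs_sub _ _).trans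
      (add_le_add (abs_sub _ _) le_rfl)) le_rfl)) le_rfl)
  have h5 : 1 * D ≤ M ^ 2 * D := by
    gcongr
    nlinarith
  linarith [abs_nonneg δ]

/-- Expansion to second order of the closing condition. -/
theorem closing_expansion (hM : 1000000 ≤ M) (hN : 1 ≤ N)
    (h₁ : PeriodicChain M κ₁ N σ s X₁ u₁ ε₁)
    (h₂ : PeriodicChain M κ₂ N σ s X₂ u₂ ε₂)
    (heq : ∀ l, l + 1 < N → stdForce κ₂ (X₂ l) (X₂ (l + 1)) (X₂ (l + 2)) =
      stdForce κ₁ (X₁ l) (X₁ (l + 1)) (X₁ (l + 2))) :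
    |stdForce κ₂ (X₂ (N - 1)) (X₂ 0) (X₂ 1) - stdForce κ₁ (X₁ (N - 1)) (X₁ 0) (X₁ 1) -
      (ε₂ * (X₂ 0 - X₁ 0) - κ₂ * (Real.cos (2 * Real.pi * X₁ 0) - Real.cos (2 * Real.pi * X₂ 0) -
        2 * Real.pi * Real.sin (2 * Real.pi * X₂ 0) * (X₂ 0 - X₁ 0)) +
        (κ₂ - κ₁) * Real.cos (2 * Real.pi * X₁ 0))| ≤
      16000 * ((X₂ 0 - X₁ 0) ^ 2 + |κ₂ - κ₁|) / M := by
  have hMpos : 0 < M := by linarith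
  have hκ₂ : 0 ≤ κ₂ := le_trans (by positivity) h₂.le_param
  set D := X₂ 0 - X₁ 0 with hD
  set δ := κ₂ - κ₁ with hδ
  have hδ1 : |δ| ≤ 1 := abs_param_sub_le h₁ h₂
  have hδ0 : 0 ≤ |δ| := abs_nonneg _
  -- After removal of its linear part `D u₂`, the displacement vanishes at both ends and solves the
  -- linearised system with a source that is quadratic in the displacement or linear in `δ`.
  have hW : ∀ l, l ≤ N → |X₂ l - X₁ l - D * u₂ l| ≤ 2 * (4000 * (D ^ 2 + |δ|)) / M := by
    refine tridiagonal_bound_of_zero (M := M) (by linarith) (by positivity) (N := N)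
      (w := fun l => X₂ l - X₁ l - D * u₂ l) (by simp [h₂.lin_zero, hD])
      (by simp [h₂.lin_last, hD, h₁.closed, h₂.closed]) ?_
    intro l hl
    set d₂ := 2 - κ₂ * (2 * Real.pi * Real.sin (2 * Real.pi * X₂ (l + 1))) with hd₂
    set r := Real.cos (2 * Real.pi * X₁ (l + 1)) - Real.cos (2 * Real.pi * X₂ (l + 1)) -
        2 * Real.pi * Real.sin (2 * Real.pi * X₂ (l + 1)) * (X₂ (l + 1) - X₁ (l + 1)) with hr
    have hd := h₂.le_abs_diag (by linarith) hl
    have hl2 := h₂.linear l hl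
    rw [← hd₂] at hd hl2
    have hrle : |r| ≤ 120 * (X₂ (l + 1) - X₁ (l + 1)) ^ 2 := abs_cos_taylor_le _ _
    have hdis := displacement_le hM h₁ h₂ heq l hl
    rw [← hD, ← hδ] at hdis
    have e : d₂ * (X₂ (l + 1) - X₁ (l + 1) - D * u₂ (l + 1)) =
        (X₂ l - X₁ l - D * u₂ l) + (X₂ (l + 2) - X₁ (l + 2) - D * u₂ (l + 2)) +
          (κ₂ * r - δ * Real.cos (2 * Real.pi * X₁ (l + 1))) := by
      have h := heq l hl
      simp only [stdForce] at h
      rw [mul_sub, ← mul_assoc, mul_comm d₂ D, mul_assoc, hl2, hd₂, hr, hδ]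
      linarith
    have hR : |κ₂ * r - δ * Real.cos (2 * Real.pi * X₁ (l + 1))| ≤ 4000 * (D ^ 2 + |δ|) := by
      have hsq : (X₂ (l + 1) - X₁ (l + 1)) ^ 2 ≤ (4 * (|D| + |δ|) / M) ^ 2 := by
        rw [← sq_abs (X₂ (l + 1) - X₁ (l + 1))]
        gcongr
      -- Here `|δ| ≤ 1` allows `δ²` to be replaced by `|δ|`.
      have hE : (|D| + |δ|) ^ 2 ≤ 2 * (D ^ 2 + |δ|) := by
        rw [← sq_abs D]
        nlinarith [sq_nonneg (|D| - |δ|)]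
      calc _ ≤ |κ₂ * r| + |δ * Real.cos (2 * Real.pi * X₁ (l + 1))| := abs_sub _ _
        _ ≤ (M ^ 2 + 1) * (120 * (4 * (|D| + |δ|) / M) ^ 2) + |δ| := by
            refine add_le_add ?_ ?_
            · rw [abs_mul, abs_of_nonneg hκ₂]
              have := h₂.param_le
              gcongr
              exact hrle.trans (by gcongr)
            · rw [abs_mul]
              exact mul_le_of_le_one_right (abs_nonneg _) (Real.abs_cos_le_one _)
        _ = (1920 + 1920 / M ^ 2) * (|D| + |δ|) ^ 2 + |δ| := by field_simp; ring
        _ ≤ 1921 * (2 * (D ^ 2 + |δ|)) + |δ| := by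
            have : 1920 / M ^ 2 ≤ 1 := by rw [div_le_one (by positivity)]; nlinarith
            gcongr
            linarith
        _ ≤ _ := by nlinarith [sq_nonneg D]
    calc M * |X₂ (l + 1) - X₁ (l + 1) - D * u₂ (l + 1)|
        ≤ |d₂ * (X₂ (l + 1) - X₁ (l + 1) - D * u₂ (l + 1))| := by rw [abs_mul]; gcongr
      _ ≤ _ := by
        rw [e]
        exact (abs_add_le _ _).trans (add_le_add (abs_add_le _ _) hR)
  have hW1 := hW 1 hN
  have hW2 := hW (N - 1) (by omega)
  set W₁ := X₂ 1 - X₁ 1 - D * u₂ 1 with hW₁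
  set W₂ := X₂ (N - 1) - X₁ (N - 1) - D * u₂ (N - 1) with hW₂
  have e : stdForce κ₂ (X₂ (N - 1)) (X₂ 0) (X₂ 1) - stdForce κ₁ (X₁ (N - 1)) (X₁ 0) (X₁ 1) -
      (ε₂ * D - κ₂ * (Real.cos (2 * Real.pi * X₁ 0) - Real.cos (2 * Real.pi * X₂ 0) -
        2 * Real.pi * Real.sin (2 * Real.pi * X₂ 0) * D) +
        δ * Real.cos (2 * Real.pi * X₁ 0)) = -W₁ - W₂ := by
    simp only [stdForce, hW₁, hW₂, h₂.defect, hδ, hD]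
    ring
  rw [e]
  refine (abs_sub _ _).trans ?_
  rw [abs_neg]
  calc _ ≤ 2 * (4000 * (D ^ 2 + |δ|)) / M + 2 * (4000 * (D ^ 2 + |δ|)) / M := add_le_add hW1 hW2
    _ = _ := by ring

/-! ### Consequences of the closing equation -/

/-- Two chains with the same itinerary and the same closing integer have close parameters. -/
theorem abs_param_sub_le_of_closing (hM : 1000000 ≤ M) (hN : 1 ≤ N)
    (h₁ : PeriodicChain M κ₁ N σ s X₁ u₁ ε₁)
    (h₂ : PeriodicChain M κ₂ N σ s X₂ u₂ ε₂)
    (heq : ∀ l, l + 1 < N → stdForce κ₂ (X₂ l) (X₂ (l + 1)) (X₂ (l + 2)) =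
      stdForce κ₁ (X₁ l) (X₁ (l + 1)) (X₁ (l + 2)))
    (hclose : stdForce κ₂ (X₂ (N - 1)) (X₂ 0) (X₂ 1) = stdForce κ₁ (X₁ (N - 1)) (X₁ 0) (X₁ 1))
    {η : ℝ} (hη : η ≤ 4) (hε₁ : |ε₁| ≤ η) (hε₂ : |ε₂| ≤ η) :
    |κ₂ - κ₁| ≤ 5 * η ^ 2 / M ^ 2 := by
  have hMpos : 0 < M := by linarith
  have hκ₂ : 0 ≤ κ₂ := le_trans (by positivity) h₂.le_param
  have hexp := closing_expansion hM hN h₁ h₂ heq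
  have hD := abs_zero_sub_le hM hN h₁ h₂ heq
  have hr := abs_cos_taylor_le (X₁ 0) (X₂ 0)
  have hδ1 : |κ₂ - κ₁| ≤ 1 := abs_param_sub_le h₁ h₂
  rw [hclose, sub_self, zero_sub, abs_neg] at hexp
  set r := Real.cos (2 * Real.pi * X₁ 0) - Real.cos (2 * Real.pi * X₂ 0) -
        2 * Real.pi * Real.sin (2 * Real.pi * X₂ 0) * (X₂ 0 - X₁ 0) with hrdef
  set D := X₂ 0 - X₁ 0 with hDdef
  set δ := κ₂ - κ₁ with hδ
  have hc : 9 / 10 ≤ |Real.cos (2 * Real.pi * X₁ 0)| := by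
    refine h₁.cos_zero.trans ((le_abs_self _).trans ?_)
    rw [abs_mul, abs_neg, abs_units_cast, one_mul]
  have h1 : 9 / 10 * |δ| ≤ |δ * Real.cos (2 * Real.pi * X₁ 0)| := by
    rw [abs_mul]
    nlinarith [abs_nonneg δ]
  have h2 : |δ * Real.cos (2 * Real.pi * X₁ 0)| ≤
      |ε₂ * D - κ₂ * r + δ * Real.cos (2 * Real.pi * X₁ 0)| + (|ε₂ * D| + |κ₂ * r|) := by
    have := abs_sub (ε₂ * D - κ₂ * r + δ * Real.cos (2 * Real.pi * X₁ 0)) (ε₂ * D - κ₂ * r)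
    rw [add_sub_cancel_left] at this
    exact this.trans (add_le_add le_rfl (abs_sub _ _))
  have h3 : |ε₂ * D| ≤ η * |D| := by rw [abs_mul]; gcongr
  have h4 : |κ₂ * r| ≤ (M ^ 2 + 1) * (120 * |D| ^ 2) := by
    rw [abs_mul, abs_of_nonneg hκ₂, sq_abs]
    have := h₂.param_le
    gcongr
  have h5 : 16000 * (D ^ 2 + |δ|) / M ≤ 1 / 50 * (|D| ^ 2 + |δ|) := by
    rw [div_le_iff₀ hMpos, sq_abs]
    nlinarith [abs_nonneg δ, sq_nonneg D]
  have hη0 : 0 ≤ η := (abs_nonneg _).trans hε₁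
  have hd0 : 0 ≤ |δ| := abs_nonneg _
  have hM2 : (1000 : ℝ) ≤ M ^ 2 := by nlinarith
  -- On this scale `a = O(η + |δ|)`, and the closing equation times `M²` becomes `M² |δ| ≲ η a +
  -- a²`.
  set a := M ^ 2 * |D| with ha
  have ha0 : 0 ≤ a := by positivity
  have ha1 : a ≤ (2 * η + |δ|) / 17 := by
    rw [le_div_iff₀ (by norm_num)]
    linarith
  have h6 : 22 / 25 * |δ| ≤ η * |D| + 121 * (M ^ 2 * |D| ^ 2) := by
    have : 1000 * |D| ^ 2 ≤ M ^ 2 * |D| ^ 2 := by gcongr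
    linarith [sq_nonneg |D|]
  have h7 : 22 / 25 * (M ^ 2 * |δ|) ≤ η * a + 121 * a ^ 2 := by
    calc 22 / 25 * (M ^ 2 * |δ|) = M ^ 2 * (22 / 25 * |δ|) := by ring
      _ ≤ M ^ 2 * (η * |D| + 121 * (M ^ 2 * |D| ^ 2)) := by gcongr
      _ = _ := by rw [ha]; ring
  have h8 : η * a ≤ η * ((2 * η + |δ|) / 17) := by gcongr
  have h9 : a ^ 2 ≤ ((2 * η + |δ|) / 17) ^ 2 := by gcongr
  -- The mixed terms are made linear in `|δ|`, so that the large multiple `M² |δ|` absorbs them and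
  -- only `η²` remains.
  have h10 : η * |δ| ≤ 4 * |δ| := by gcongr
  have h11 : |δ| ^ 2 ≤ |δ| := by nlinarith
  have h12 : 1000 * |δ| ≤ M ^ 2 * |δ| := by gcongr
  rw [le_div_iff₀ (by positivity)]
  nlinarith [sq_nonneg η]

/-- If two distinct chains with the same parameter and the same itinerary close up with the same
integer, the sign of the defect at one of them is determined by the direction to the other. -/
theorem defect_mul_pos (hM : 1000000 ≤ M) (hN : 1 ≤ N)
    (h₁ : PeriodicChain M κ₁ N σ s X₁ u₁ ε₁)
    (h₂ : PeriodicChain M κ₁ N σ s X₂ u₂ ε₂)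
    (heq : ∀ l, l + 1 < N → stdForce κ₁ (X₂ l) (X₂ (l + 1)) (X₂ (l + 2)) =
      stdForce κ₁ (X₁ l) (X₁ (l + 1)) (X₁ (l + 2)))
    (hclose : stdForce κ₁ (X₂ (N - 1)) (X₂ 0) (X₂ 1) = stdForce κ₁ (X₁ (N - 1)) (X₁ 0) (X₁ 1))
    (hne : X₂ 0 ≠ X₁ 0) : 0 < ((σ : ℤ) : ℝ) * ε₂ * (X₂ 0 - X₁ 0) := by
  have hMpos : 0 < M := by linarith
  have hexp := closing_expansion hM hN h₁ h₂ heq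
  have hsin : |Real.sin (2 * Real.pi * X₂ 0)| ≤ 1 / 1000 := by
    refine h₂.sin_zero.trans ?_
    rw [div_le_div_iff₀ hMpos (by norm_num)]
    linarith
  have hgap := cos_tangent_gap (units_cast_cases σ)
    (abs_sub_le_half h₁.near_zero h₂.near_zero) h₂.cos_zero hsin
  rw [hclose, sub_self, zero_sub, abs_neg, sub_self, zero_mul, add_zero, abs_zero, add_zero] at hexp
  set r := Real.cos (2 * Real.pi * X₁ 0) - Real.cos (2 * Real.pi * X₂ 0) -
        2 * Real.pi * Real.sin (2 * Real.pi * X₂ 0) * (X₂ 0 - X₁ 0) with hrdef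
  set D := X₂ 0 - X₁ 0 with hDdef
  have hD2 : 0 < D ^ 2 := by
    have : D ≠ 0 := sub_ne_zero.2 hne
    positivity
  -- The expansion error is at most `D²`, whereas the tangent gap contributes at least `2 D²`.
  have h5 : 16000 * D ^ 2 / M ≤ D ^ 2 := by
    rw [div_le_iff₀ hMpos]
    nlinarith
  have h6 : |((σ : ℤ) : ℝ) * (ε₂ * D - κ₁ * r)| ≤ D ^ 2 := by
    rw [abs_mul, abs_units_cast, one_mul]
    linarith
  have h7 := (abs_le.1 h6).1
  have h8 : 1 * (2 * D ^ 2) ≤ κ₁ * (((σ : ℤ) : ℝ) * r) := by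
    have : 1 ≤ κ₁ := by nlinarith [h₁.le_param]
    gcongr
  nlinarith

/-- At a fixed parameter, two chains with the same itinerary and with defects of the same sign
coincide. -/
theorem eq_of_defect_mul_pos (hM : 1000000 ≤ M) (hN : 1 ≤ N)
    (h₁ : PeriodicChain M κ₁ N σ s X₁ u₁ ε₁)
    (h₂ : PeriodicChain M κ₁ N σ s X₂ u₂ ε₂)
    (heq : ∀ l, l + 1 < N → stdForce κ₁ (X₂ l) (X₂ (l + 1)) (X₂ (l + 2)) =
      stdForce κ₁ (X₁ l) (X₁ (l + 1)) (X₁ (l + 2)))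
    {j₁ j₂ : ℤ} (hj₁ : stdForce κ₁ (X₁ (N - 1)) (X₁ 0) (X₁ 1) = j₁)
    (hj₂ : stdForce κ₁ (X₂ (N - 1)) (X₂ 0) (X₂ 1) = j₂)
    (hε₁ : |ε₁| ≤ 4) (hε₂ : |ε₂| ≤ 4) (hε : 0 < ε₁ * ε₂) :
    ∀ l, l ≤ N → X₂ l = X₁ l := by
  have hMpos : 0 < M := by linarith
  have hκ₁ : 0 ≤ κ₁ := le_trans (by positivity) h₁.le_param
  have hD := abs_zero_sub_le hM hN h₁ h₂ heq
  rw [sub_self, abs_zero, add_zero] at hD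
  -- Since `M² |D| ≤ 1`, the closing values differ by `O(|D|)`, hence by less than one.
  have hj : j₂ = j₁ := by
    have hexp := closing_expansion hM hN h₁ h₂ heq
    have hr := abs_cos_taylor_le (X₁ 0) (X₂ 0)
    rw [hj₁, hj₂, sub_self, zero_mul, add_zero, abs_zero, add_zero] at hexp
    set r := Real.cos (2 * Real.pi * X₁ 0) - Real.cos (2 * Real.pi * X₂ 0) -
        2 * Real.pi * Real.sin (2 * Real.pi * X₂ 0) * (X₂ 0 - X₁ 0) with hrdef
    set D := X₂ 0 - X₁ 0 with hDdef
    have hM2 : (10000 : ℝ) ≤ M ^ 2 := by nlinarith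
    have hd0 := abs_nonneg D
    have ha : M ^ 2 * |D| ≤ 1 := by linarith
    have hDs : |D| ≤ 1 / 10000 := by nlinarith
    have h3 : |ε₂ * D| ≤ 4 * |D| := by rw [abs_mul]; gcongr
    have h4 : |κ₁ * r| ≤ (M ^ 2 + 1) * (120 * |D| ^ 2) := by
      rw [abs_mul, abs_of_nonneg hκ₁, sq_abs]
      have := h₁.param_le
      gcongr
    have h5 : 16000 * D ^ 2 / M ≤ |D| ^ 2 := by
      rw [div_le_iff₀ hMpos, sq_abs]
      nlinarith [sq_nonneg D]
    have h6 : |(j₂ : ℝ) - j₁| ≤ 16000 * D ^ 2 / M + (|ε₂ * D| + |κ₁ * r|) := by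
      have := abs_add_le ((j₂ : ℝ) - j₁ - (ε₂ * D - κ₁ * r)) (ε₂ * D - κ₁ * r)
      rw [sub_add_cancel] at this
      exact this.trans (add_le_add hexp (abs_sub _ _))
    have h7 : M ^ 2 * |D| ^ 2 ≤ |D| := by
      calc M ^ 2 * |D| ^ 2 = (M ^ 2 * |D|) * |D| := by ring
        _ ≤ 1 * |D| := by gcongr
        _ = _ := one_mul _
    have h8 : |D| ^ 2 ≤ |D| := by nlinarith
    have h9 : |(j₂ : ℝ) - j₁| < 1 := by linarith
    have h10 : |j₂ - j₁| < 1 := by exact_mod_cast h9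
    have := Int.abs_lt_one_iff.1 h10
    omega
  have hclose : stdForce κ₁ (X₂ (N - 1)) (X₂ 0) (X₂ 1) =
      stdForce κ₁ (X₁ (N - 1)) (X₁ 0) (X₁ 1) := by rw [hj₁, hj₂, hj]
  have h0 : X₂ 0 = X₁ 0 := by
    by_contra hne
    -- The sign rule, applied from each chain to the other, makes the two defects opposite in sign.
    have a := defect_mul_pos hM hN h₁ h₂ heq hclose hne
    have b := defect_mul_pos hM hN h₂ h₁ (fun l hl => (heq l hl).symm) hclose.symm (Ne.symm hne)
    have hσ : ((σ : ℤ) : ℝ) ^ 2 = 1 := by rcases units_cast_cases σ with h | h <;> simp [h]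
    have hab := mul_pos a b
    have e : ((σ : ℤ) : ℝ) * ε₂ * (X₂ 0 - X₁ 0) * (((σ : ℤ) : ℝ) * ε₁ * (X₁ 0 - X₂ 0)) =
        -(((σ : ℤ) : ℝ) ^ 2 * (ε₁ * ε₂) * (X₂ 0 - X₁ 0) ^ 2) := by ring
    rw [e, hσ, one_mul] at hab
    nlinarith [mul_nonneg hε.le (sq_nonneg (X₂ 0 - X₁ 0))]
  intro l hl
  rcases Nat.eq_zero_or_pos l with rfl | hl0
  · exact h0
  rcases hl.eq_or_lt with rfl | hl1
  · rw [h₁.closed, h₂.closed, h0]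
  obtain ⟨k, rfl⟩ : ∃ k, l = k + 1 := ⟨l - 1, by omega⟩
  have := displacement_le hM h₁ h₂ heq k hl1
  rw [h0, sub_self, sub_self, abs_zero, add_zero, mul_zero, zero_div] at this
  exact sub_eq_zero.1 (abs_nonpos_iff.1 this)

/-- The closing integer is determined by the parameter up to a bounded error. -/
theorem abs_closing_add_le (hM : 1000000 ≤ M) (h₁ : PeriodicChain M κ₁ N σ s X₁ u₁ ε₁)
    (hN : 1 ≤ N) : |stdForce κ₁ (X₁ (N - 1)) (X₁ 0) (X₁ 1) + ((σ : ℤ) : ℝ) * M ^ 2| ≤ 2000 := by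
  have hMpos : 0 < M := by linarith
  have hcen : ∀ k s, |center k s| ≤ 3 / 4 := by
    intro k s
    rcases k <;> simp only [center] <;> split_ifs <;> norm_num [abs_le]
  have hX : ∀ l, l ≤ N → |X₁ l| ≤ 1 := by
    have key : ∀ x c : ℝ, |x - c| ≤ 1 / 4 → |c| ≤ 3 / 4 → |x| ≤ 1 := by
      intro x c h1 h2
      have := abs_add_le (x - c) c
      rw [sub_add_cancel] at this
      linarith
    intro l hl
    rcases Nat.eq_zero_or_pos l with rfl | hl0
    · exact key _ _ h₁.near_zero (hcen _ _)
    rcases hl.eq_or_lt with rfl | hl1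
    · rw [h₁.closed]; exact key _ _ h₁.near_zero (hcen _ _)
    obtain ⟨k, rfl⟩ : ∃ k, l = k + 1 := ⟨l - 1, by omega⟩
    exact key _ _ (h₁.near k hl1) (hcen _ _)
  have hx0 := abs_le.1 (hX 0 (by omega))
  have hx1 := abs_le.1 (hX 1 hN)
  have hx2 := abs_le.1 (hX (N - 1) (by omega))
  have hc := h₁.cos_zero
  have hs : Real.sin (2 * Real.pi * X₁ 0) ^ 2 ≤ 1681 / M ^ 2 := by
    rw [← sq_abs, show 1681 / M ^ 2 = (41 / M) ^ 2 by ring]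
    have := h₁.sin_zero
    gcongr
  have hle := Real.cos_le_one (2 * Real.pi * X₁ 0)
  have hge := Real.neg_one_le_cos (2 * Real.pi * X₁ 0)
  have hsc := Real.sin_sq_add_cos_sq (2 * Real.pi * X₁ 0)
  have hb : M ^ 2 * (1681 / M ^ 2) = 1681 := by field_simp
  have hb2 : 1681 / M ^ 2 ≤ 1 := by rw [div_le_one (by positivity)]; nlinarith
  have hk1 := h₁.le_param
  have hk2 := h₁.param_le
  -- As `|sin| ≤ 41/M`, the modulus `c` of the cosine satisfies `c ≥ c² ≥ 1 - 1681/M²`, so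
  -- multiplying by `κ` leaves a bounded error.
  have main : ∀ c : ℝ, 9 / 10 ≤ c → c ≤ 1 → Real.sin (2 * Real.pi * X₁ 0) ^ 2 + c ^ 2 = 1 →
      |κ₁ * c - M ^ 2| ≤ 1700 := by
    intro c h1 h2 h3
    have h4 : 1 - 1681 / M ^ 2 ≤ c := by nlinarith
    rw [abs_le]
    have hMM : 0 < M ^ 2 := by positivity
    constructor
    · have : M ^ 2 * (1 - 1681 / M ^ 2) ≤ κ₁ * c := by gcongr; linarith
      rw [mul_sub, hb] at this
      linarith
    · nlinarith
  have habs : |2 * X₁ 0 - X₁ (N - 1) - X₁ 1| ≤ 4 := by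
    rw [abs_le]; constructor <;> linarith [hx0.1, hx0.2, hx1.1, hx1.2, hx2.1, hx2.2]
  simp only [stdForce]
  rcases units_cast_cases σ with h | h <;> rw [h] at hc ⊢
  · have := main (-Real.cos (2 * Real.pi * X₁ 0)) (by linarith) (by linarith) (by linarith)
    rw [abs_le] at this habs ⊢
    constructor <;> linarith [this.1, this.2, habs.1, habs.2]
  · have := main (Real.cos (2 * Real.pi * X₁ 0)) (by linarith) (by linarith) (by linarith)
    rw [abs_le] at this habs ⊢
    constructor <;> linarith [this.1, this.2, habs.1, habs.2]

end PeriodicChain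

/-! ### Charts on the strips -/

/-- The representative of a point of the circle within half a period of a marked point. -/
def chart (z : Kind) (s : ℤˣ) (x : UnitAddCircle) : ℝ :=
  (AddCircle.equivIco 1 (center z s - 1 / 2) x : ℝ)

theorem coe_chart (z : Kind) (s : ℤˣ) (x : UnitAddCircle) :
    (chart z s x : UnitAddCircle) = x := AddCircle.coe_equivIco

theorem chart_coe {z : Kind} {s : ℤˣ} {t : ℝ} (h₁ : center z s - 1 / 2 ≤ t)
    (h₂ : t < center z s + 1 / 2) : chart z s (t : UnitAddCircle) = t :=
  AddCircle.equivIco_coe_of_mem ⟨h₁, by linarith⟩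

theorem chart_bounds (z : Kind) (s : ℤˣ) (x : UnitAddCircle) :
    center z s - 1 / 2 ≤ chart z s x ∧ chart z s x < center z s + 1 / 2 := by
  have h := (AddCircle.equivIco 1 (center z s - 1 / 2) x).2
  exact ⟨h.1, by have := h.2; change chart z s x < _ at this; linarith⟩

theorem dphi_coe (t : ℝ) : dphi (t : UnitAddCircle) = Real.cos (2 * Real.pi * t) := rfl

theorem ddphi_coe (t : ℝ) :
    ddphi (t : UnitAddCircle) = -(2 * Real.pi) * Real.sin (2 * Real.pi * t) := rfl

theorem dddphi_coe (t : ℝ) :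
    dddphi (t : UnitAddCircle) = -(2 * Real.pi) ^ 2 * Real.cos (2 * Real.pi * t) := rfl

theorem continuous_dphi : Continuous dphi := by
  refine isQuotientMap_quotient_mk'.continuous_iff.2 ?_
  change Continuous fun t : ℝ => Real.cos (2 * Real.pi * t)
  fun_prop

theorem continuous_ddphi : Continuous ddphi := by
  refine isQuotientMap_quotient_mk'.continuous_iff.2 ?_
  change Continuous fun t : ℝ => -(2 * Real.pi) * Real.sin (2 * Real.pi * t)
  fun_prop

theorem continuous_dddphi : Continuous dddphi := by
  refine isQuotientMap_quotient_mk'.continuous_iff.2 ?_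
  change Continuous fun t : ℝ => -(2 * Real.pi) ^ 2 * Real.cos (2 * Real.pi * t)
  fun_prop

/-- A point within half a period of the center at which the relative cosine is positive is within
a quarter of a period of the center. -/
theorem abs_sub_le_of_cos_pos {x c : ℝ} (h₁ : c - 1 / 2 ≤ x) (h₂ : x < c + 1 / 2)
    (hc : 0 < Real.cos (2 * Real.pi * (x - c))) : |x - c| ≤ 1 / 4 := by
  have hpi := Real.pi_pos
  by_contra! h
  have habs : |x - c| ≤ 1 / 2 := by rw [abs_le]; constructor <;> linarith
  have : Real.cos (2 * Real.pi * |x - c|) ≤ 0 :=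
    Real.cos_nonpos_of_pi_div_two_le_of_le (by nlinarith) (by nlinarith)
  rw [← Real.cos_abs, abs_mul, abs_of_pos (by positivity : 0 < 2 * Real.pi)] at hc
  linarith

theorem rpow_neg_half_bounds {M κ : ℝ} (hM : 1 ≤ M) (h₁ : M ^ 2 ≤ κ) (h₂ : κ ≤ M ^ 2 + 1) :
    1 / (M + 1) ≤ κ ^ (-(1 / 2) : ℝ) ∧ κ ^ (-(1 / 2) : ℝ) ≤ 1 / M := by
  have hMpos : 0 < M := by linarith
  have hκ : 0 < κ := lt_of_lt_of_le (by positivity) h₁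
  rw [Real.rpow_neg hκ.le, ← Real.sqrt_eq_rpow, ← one_div]
  have h3 : M ≤ √κ := Real.le_sqrt_of_sq_le h₁
  have h4 : √κ ≤ M + 1 := Real.sqrt_le_iff.2 ⟨by linarith, by nlinarith⟩
  constructor
  · exact one_div_le_one_div_of_le (by linarith) h4
  · exact one_div_le_one_div_of_le hMpos h3

/-- The inner threshold `τ/10 = 8π` gives `2π |sin| ≥ 8π κ^(-1/2) - 2/κ`, which still exceeds
`2π/M`. The sign of `h₁` then places the point in the right half period. -/
theorem chart_of_mem_proj_d {M κ : ℝ} (hM : 1000000 ≤ M) (h₁ : M ^ 2 ≤ κ) (h₂ : κ ≤ M ^ 2 + 1)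
    {s : ℤˣ} {x : UnitAddCircle} (hx : x ∈ proj κ .d s) :
    |chart .d s x - center .d s| ≤ 1 / 4 ∧
      1 / M ≤ -((s : ℤ) : ℝ) * Real.sin (2 * Real.pi * chart .d s x) := by
  have hMpos : 0 < M := by linarith
  have hpi3 : 3 < Real.pi := Real.pi_gt_three
  obtain ⟨hx1, hx2⟩ := hx
  simp only [projCrit, Set.mem_ofPred_eq, not_lt, tau] at hx1
  have hrp := (rpow_neg_half_bounds (by linarith) h₁ h₂).1
  have hsl : slope₁ κ x = -(2 * Real.pi) * Real.sin (2 * Real.pi * chart .d s x) + 2 / κ := by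
    rw [slope₁]
    conv_lhs => rw [← coe_chart .d s x, ddphi_coe]
  have habs : |slope₁ κ x| = ((s : ℤ) : ℝ) * slope₁ κ x := by
    rw [← abs_of_pos hx2, abs_mul, abs_units_cast, one_mul]
  rw [habs, hsl] at hx1
  set S := Real.sin (2 * Real.pi * chart .d s x) with hS
  have h2κ : 2 / κ ≤ 2 / M ^ 2 := by gcongr
  have h2κ' : 0 ≤ 2 / κ := div_nonneg zero_le_two (le_trans (by positivity) h₁)
  have h3 : 8 * Real.pi * (1 / (M + 1)) ≤
      ((s : ℤ) : ℝ) * (-(2 * Real.pi) * S + 2 / κ) := by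
    refine le_trans ?_ hx1
    rw [show 80 * Real.pi / 10 = 8 * Real.pi by ring]
    gcongr
  have h4 : ((s : ℤ) : ℝ) * (2 / κ) ≤ 2 / M ^ 2 := by
    rcases units_cast_cases s with h | h <;> rw [h] <;> linarith
  have h5 : 2 * Real.pi * (1 / M) + 2 / M ^ 2 ≤ 8 * Real.pi * (1 / (M + 1)) := by
    have e1 : 1 / M ≤ 2 * (1 / (M + 1)) := by
      rw [← mul_div_assoc, div_le_div_iff₀ hMpos (by linarith)]; linarith
    have e2 : 2 / M ^ 2 ≤ 2 * (1 / M) := by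
      rw [← mul_div_assoc, div_le_div_iff₀ (by positivity) hMpos]; nlinarith
    have e3 : 0 < 1 / M := by positivity
    nlinarith
  have h6 : 1 / M ≤ -((s : ℤ) : ℝ) * S := by
    have : 2 * Real.pi * (1 / M) ≤ 2 * Real.pi * (-((s : ℤ) : ℝ) * S) := by linarith
    exact le_of_mul_le_mul_left this (by positivity)
  refine ⟨?_, h6⟩
  have hb := chart_bounds .d s x
  refine abs_sub_le_of_cos_pos hb.1 hb.2 ?_
  rw [cos_center_d]
  exact lt_of_lt_of_le (by positivity) h6

/-- Of the constant 41, the part 40 is `τ/(2π)` and the rest covers `2/κ`. A small sine makes the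
cosine close to `±1`, and the third derivative selects the sign. -/
theorem chart_of_mem_proj_c {M κ : ℝ} (hM : 1000000 ≤ M) (h₁ : M ^ 2 ≤ κ) (h₂ : κ ≤ M ^ 2 + 1)
    {s : ℤˣ} {x : UnitAddCircle} (hx : x ∈ proj κ .c s) :
    |chart .c s x - center .c s| ≤ 1 / 4 ∧
      9 / 10 ≤ -((s : ℤ) : ℝ) * Real.cos (2 * Real.pi * chart .c s x) ∧
      |Real.sin (2 * Real.pi * chart .c s x)| ≤ 41 / M := by
  have hMpos : 0 < M := by linarith
  have hpi3 : 3 < Real.pi := Real.pi_gt_three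
  have hx' : |slope₁ κ x| ≤ tau * κ ^ (-(1 / 2) : ℝ) ∧ 0 ≤ ((s : ℤ) : ℝ) * dddphi x := by
    -- The closure retains only weak inequalities; `sin² + cos² = 1` makes the second one
    -- quantitative again.
    have hcl : IsClosed {x | |slope₁ κ x| ≤ tau * κ ^ (-(1 / 2) : ℝ) ∧
        0 ≤ ((s : ℤ) : ℝ) * dddphi x} := by
      have c1 : Continuous fun x => |slope₁ κ x| := (continuous_ddphi.add continuous_const).abs
      have c2 : Continuous fun x => ((s : ℤ) : ℝ) * dddphi x :=
        continuous_const.mul continuous_dddphi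
      exact (isClosed_le c1 continuous_const).inter (isClosed_le continuous_const c2)
    refine closure_minimal ?_ hcl hx
    rintro y ⟨hy1, hy2⟩
    exact ⟨le_of_lt hy1, hy2.le⟩
  obtain ⟨hx1, hx2⟩ := hx'
  have hrp := (rpow_neg_half_bounds (by linarith) h₁ h₂).2
  have hsl : slope₁ κ x = -(2 * Real.pi) * Real.sin (2 * Real.pi * chart .c s x) + 2 / κ := by
    rw [slope₁]
    conv_lhs => rw [← coe_chart .c s x, ddphi_coe]
  have hdd : dddphi x = -(2 * Real.pi) ^ 2 * Real.cos (2 * Real.pi * chart .c s x) := by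
    conv_lhs => rw [← coe_chart .c s x, dddphi_coe]
  rw [hsl, tau] at hx1
  rw [hdd] at hx2
  set S := Real.sin (2 * Real.pi * chart .c s x) with hS
  set Co := Real.cos (2 * Real.pi * chart .c s x) with hCo
  have h2κ : 2 / κ ≤ 2 / M ^ 2 := by gcongr
  have h2κ' : 0 ≤ 2 / κ := div_nonneg zero_le_two (le_trans (by positivity) h₁)
  have h3 : |2 * Real.pi * S| ≤ 80 * Real.pi * (1 / M) + 2 * (1 / M) := by
    have e2 : 2 / M ^ 2 ≤ 2 * (1 / M) := by
      rw [← mul_div_assoc, div_le_div_iff₀ (by positivity) hMpos]; nlinarith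
    have e4 : 80 * Real.pi * κ ^ (-(1 / 2) : ℝ) ≤ 80 * Real.pi * (1 / M) := by gcongr
    rw [abs_le] at hx1 ⊢
    have e3 : 0 < 1 / M := by positivity
    constructor <;> linarith [hx1.1, hx1.2]
  have h4 : |S| ≤ 41 / M := by
    rw [abs_mul, abs_of_pos (by positivity : 0 < 2 * Real.pi)] at h3
    have e3 : 0 < 1 / M := by positivity
    have : 2 * Real.pi * |S| ≤ 2 * Real.pi * (41 / M) := by
      rw [show 41 / M = 41 * (1 / M) by ring]
      nlinarith
    exact le_of_mul_le_mul_left this (by positivity)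
  have h5 : 0 ≤ -((s : ℤ) : ℝ) * Co := by
    have : 0 ≤ (2 * Real.pi) ^ 2 * (-((s : ℤ) : ℝ) * Co) := by linarith
    exact nonneg_of_mul_nonneg_right this (by positivity)
  have h6 : 9 / 10 ≤ -((s : ℤ) : ℝ) * Co := by
    have e1 : S ^ 2 + Co ^ 2 = 1 := Real.sin_sq_add_cos_sq _
    have e2 : 41 / M ≤ 1 / 10 := by rw [div_le_div_iff₀ hMpos (by norm_num)]; linarith
    have e3 : S ^ 2 ≤ (1 / 10) ^ 2 := by
      rw [← sq_abs]; gcongr; exact h4.trans e2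
    have e4 : (-((s : ℤ) : ℝ) * Co) ^ 2 = Co ^ 2 := by
      rcases units_cast_cases s with h | h <;> rw [h] <;> ring
    nlinarith
  refine ⟨?_, h6, h4⟩
  have hb := chart_bounds .c s x
  refine abs_sub_le_of_cos_pos hb.1 hb.2 ?_
  rw [cos_center_c]
  linarith

theorem chart_near {M κ : ℝ} (hM : 1000000 ≤ M) (h₁ : M ^ 2 ≤ κ) (h₂ : κ ≤ M ^ 2 + 1)
    {z : Kind} {s : ℤˣ} {x : UnitAddCircle} (hx : x ∈ proj κ z s) :
    |chart z s x - center z s| ≤ 1 / 4 := by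
  cases z
  · exact (chart_of_mem_proj_c hM h₁ h₂ hx).1
  · exact (chart_of_mem_proj_d hM h₁ h₂ hx).1

/-- A chart jumps only at the point opposite its center, and the strip stays within a quarter period
of the center. -/
theorem continuousOn_chart {M κ : ℝ} (hM : 1000000 ≤ M) (h₁ : M ^ 2 ≤ κ) (h₂ : κ ≤ M ^ 2 + 1)
    (z : Kind) (s : ℤˣ) : ContinuousOn (chart z s) (proj κ z s) := by
  intro x hx
  refine ContinuousAt.continuousWithinAt (continuousAt_subtype_val.comp
    (AddCircle.continuousAt_equivIco 1 (center z s - 1 / 2) ?_))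
  rintro rfl
  have h := chart_near hM h₁ h₂ hx
  rw [chart_coe le_rfl (by linarith), abs_le] at h
  linarith [h.1]

/-! ### The integer attached to a rectangle -/

theorem continuous_stdMap (κ : ℝ) : Continuous (stdMap κ) := by
  have := continuous_dphi
  change Continuous fun p : Torus =>
    ((p.2, -p.1 + 2 • p.2 + ((κ * dphi p.2 : ℝ) : UnitAddCircle)) : Torus)
  have h : Continuous fun p : Torus => ((κ * dphi p.2 : ℝ) : UnitAddCircle) :=
    (AddCircle.continuous_mk' (1 : ℝ)).comp (by fun_prop)
  fun_prop

theorem continuous_stdMap_symm (κ : ℝ) : Continuous (stdMap κ).symm := by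
  have := continuous_dphi
  change Continuous fun p : Torus =>
    ((2 • p.1 - p.2 + ((κ * dphi p.1 : ℝ) : UnitAddCircle), p.1) : Torus)
  have h : Continuous fun p : Torus => ((κ * dphi p.1 : ℝ) : UnitAddCircle) :=
    (AddCircle.continuous_mk' (1 : ℝ)).comp (by fun_prop)
  fun_prop

/-- The Euler–Lagrange operator in the charts of a symbol. -/
def symbolForce (κ : ℝ) (a : Symbol) (p : Torus) : ℝ :=
  stdForce κ (chart a.prevKind a.prevSign ((stdMap κ).symm p).1) (chart .d a.sign p.1)
    (chart a.nextKind a.nextSign (stdMap κ p).1)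

/-- Lifts of three consecutive points of an orbit have integer Euler–Lagrange defect. -/
theorem exists_int_stdForce {κ X Y Z : ℝ} {p : Torus} (hX : (X : UnitAddCircle) = p.1)
    (hY : (Y : UnitAddCircle) = p.2) (hZ : (Z : UnitAddCircle) = (stdMap κ p).2) :
    ∃ j : ℤ, stdForce κ X Y Z = j := by
  have h : ((stdForce κ X Y Z : ℝ) : UnitAddCircle) = 0 := by
    have e : stdForce κ X Y Z = (Y + Y) + κ * Real.cos (2 * Real.pi * Y) - X - Z := by
      rw [stdForce]; ring
    rw [e, ← dphi_coe, AddCircle.coe_sub, AddCircle.coe_sub, AddCircle.coe_add, AddCircle.coe_add,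
      hX, hY, hZ]
    change p.2 + p.2 + ((κ * dphi p.2 : ℝ) : UnitAddCircle) - p.1 -
      (-p.1 + 2 • p.2 + ((κ * dphi p.2 : ℝ) : UnitAddCircle)) = 0
    rw [two_nsmul]
    abel
  obtain ⟨j, hj⟩ := (AddCircle.coe_eq_zero_iff 1).1 h
  exact ⟨j, by rw [← hj]; simp⟩

theorem exists_int_symbolForce (κ : ℝ) (a : Symbol) (p : Torus) :
    ∃ j : ℤ, symbolForce κ a p = j := by
  refine exists_int_stdForce (p := (stdMap κ).symm p) (coe_chart _ _ _) ?_ ?_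
  · exact coe_chart _ _ _
  · rw [coe_chart, Equiv.apply_symm_apply]
    rfl

theorem continuousOn_symbolForce {M κ : ℝ} (hM : 1000000 ≤ M) (h₁ : M ^ 2 ≤ κ)
    (h₂ : κ ≤ M ^ 2 + 1) (a : Symbol) : ContinuousOn (symbolForce κ a) (region κ a) := by
  have c1 : ContinuousOn (fun p => chart a.prevKind a.prevSign ((stdMap κ).symm p).1)
      (region κ a) :=
    (continuousOn_chart hM h₁ h₂ a.prevKind a.prevSign).comp
      (continuous_fst.comp (continuous_stdMap_symm κ)).continuousOn fun p hp => hp.1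
  have c2 : ContinuousOn (fun p : Torus => chart .d a.sign p.1) (region κ a) :=
    (continuousOn_chart hM h₁ h₂ .d a.sign).comp continuous_fst.continuousOn fun p hp => hp.2.1
  have c3 : ContinuousOn (fun p => chart a.nextKind a.nextSign (stdMap κ p).1) (region κ a) :=
    (continuousOn_chart hM h₁ h₂ a.nextKind a.nextSign).comp
      (continuous_fst.comp (continuous_stdMap κ)).continuousOn fun p hp => hp.2.2
  unfold symbolForce stdForce
  fun_prop

/-- On the rectangle of a symbol, the Euler–Lagrange operator in charts is an integer determined by
the index of the symbol. -/
theorem floor_symbolForce {M κ : ℝ} (hM : 1000000 ≤ M) (h₁ : M ^ 2 ≤ κ) (h₂ : κ ≤ M ^ 2 + 1)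
    {a : Symbol} {p : Torus} (hp : p ∈ rectangle κ a) :
    ⌊((a.sign : ℤ) : ℝ) * (symbolForce κ a p + center a.prevKind a.prevSign +
      center a.nextKind a.nextSign - 2 * center .d a.sign) +
        center a.nextKind a.nextSign - center a.prevKind a.prevSign⌋ = a.index := by
  obtain ⟨q, ⟨hq1, hq2, hq3, t, ht, htq, hfl⟩, hpq⟩ := hp
  have hqr : q ∈ region κ a := by
    by_contra hcon
    rw [connectedComponentIn_eq_empty hcon] at hpq
    exact hpq
  -- A continuous integer-valued function is constant on a connected set, so it may be evaluated at
  -- the marked point `q`.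
  have hconst : symbolForce κ a p = symbolForce κ a q := by
    refine isPreconnected_connectedComponentIn.constant_of_mapsTo
      (T := Set.range ((↑) : ℤ → ℝ)) ?_
      ((continuousOn_symbolForce hM h₁ h₂ a).mono (connectedComponentIn_subset _ _)) ?_ hpq
      (mem_connectedComponentIn hqr)
    · exact Int.isClosedEmbedding_coe_real.isEmbedding.isDiscrete_range
    · intro x _
      obtain ⟨j, hj⟩ := exists_int_symbolForce κ a x
      exact ⟨j, hj.symm⟩
  -- The two representatives differ by 0 or 1; a difference of 1 would put the chart value at 1,
  -- where the sine vanishes.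
  have hxt : chart .d a.sign q.1 = t := by
    rw [← htq]
    obtain ⟨hn, hsin⟩ := chart_of_mem_proj_d hM h₁ h₂ hq2
    have hle := abs_le.1 hn
    obtain ⟨j, hj⟩ : ∃ j : ℤ, chart .d a.sign q.1 - t = j := by
      have h : ((chart .d a.sign q.1 - t : ℝ) : UnitAddCircle) = 0 := by
        rw [AddCircle.coe_sub, coe_chart, htq, sub_self]
      obtain ⟨j, hj⟩ := (AddCircle.coe_eq_zero_iff 1).1 h
      exact ⟨j, by rw [← hj]; simp⟩
    rw [htq]
    set X := chart .d a.sign q.1 with hX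
    have hc : 1 / 4 ≤ center .d a.sign ∧ center .d a.sign ≤ 3 / 4 := by
      simp only [center]
      split_ifs <;> norm_num
    have hlo : (-1 : ℝ) < j := by linarith [ht.2, hle.1, hc.1]
    have hhi : (j : ℝ) ≤ 1 := by linarith [ht.1, hle.2, hc.2]
    have hlo' : -1 < j := by exact_mod_cast hlo
    have hhi' : j ≤ 1 := by exact_mod_cast hhi
    obtain rfl | rfl : j = 0 ∨ j = 1 := by omega
    · push_cast at hj
      linarith
    · exfalso
      push_cast at hj
      have hX1 : X = 1 := by linarith [ht.1, hle.2, hc.2]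
      rw [hX1, mul_one, Real.sin_two_pi, mul_zero] at hsin
      have : 0 < 1 / M := by positivity
      linarith
  rw [hconst, ← hfl]
  have e : symbolForce κ a q = 2 * t + κ * dphi q.1 - center a.prevKind a.prevSign -
      center a.nextKind a.nextSign := by
    rw [symbolForce, stdForce, hq1, hq3, chart_coe (by linarith) (by linarith),
      chart_coe (by linarith) (by linarith), hxt, ← htq, dphi_coe]
  rw [e]
  congr 2
  ring

/-- The index fixes the floor of plus or minus an integer shifted by a constant that depends only on
the symbol, hence the integer itself. This makes orbits at different parameters comparable. -/
theorem symbolForce_eq {M κ₁ κ₂ : ℝ} (hM : 1000000 ≤ M) (h₁ : M ^ 2 ≤ κ₁) (h₁' : κ₁ ≤ M ^ 2 + 1)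
    (h₂ : M ^ 2 ≤ κ₂) (h₂' : κ₂ ≤ M ^ 2 + 1)
    {a : Symbol} {p₁ p₂ : Torus} (hp₁ : p₁ ∈ rectangle κ₁ a) (hp₂ : p₂ ∈ rectangle κ₂ a) :
    symbolForce κ₁ a p₁ = symbolForce κ₂ a p₂ := by
  have f1 := floor_symbolForce hM h₁ h₁' hp₁
  have f2 := floor_symbolForce hM h₂ h₂' hp₂
  obtain ⟨j₁, hj₁⟩ := exists_int_symbolForce κ₁ a p₁
  obtain ⟨j₂, hj₂⟩ := exists_int_symbolForce κ₂ a p₂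
  rw [hj₁] at f1
  rw [hj₂] at f2
  have h := Int.abs_sub_lt_one_of_floor_eq_floor (f1.trans f2.symm)
  have h' : |(j₁ : ℝ) - j₂| < 1 := by
    rw [abs_lt] at h ⊢
    rcases units_cast_cases a.sign with hs | hs <;> rw [hs] at h <;>
      constructor <;> linarith [h.1, h.2]
  have h'' : |j₁ - j₂| < 1 := by exact_mod_cast h'
  have := Int.abs_lt_one_iff.1 h''
  rw [hj₁, hj₂, sub_eq_zero.1 this]

/-! ### The differential along an orbit -/

/-- The `l`-th configuration coordinate of an orbit. -/
def coord (κ : ℝ) (p : Torus) (l : ℕ) : UnitAddCircle := ((stdMap κ)^[l] p).1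

theorem iterate_snd (κ : ℝ) (p : Torus) (l : ℕ) : ((stdMap κ)^[l] p).2 = coord κ p (l + 1) := by
  rw [coord, Function.iterate_succ_apply']
  rfl

/-- The second difference of the orbit at the time `l`, as a diagonal entry of the Jacobi matrix. -/
def diag (κ : ℝ) (p : Torus) (l : ℕ) : ℝ := 2 + κ * ddphi (coord κ p l)

theorem diag_eq {κ : ℝ} {p : Torus} {l : ℕ} {X : ℝ} (hX : (X : UnitAddCircle) = coord κ p l) :
    diag κ p l = 2 - κ * (2 * Real.pi * Real.sin (2 * Real.pi * X)) := by
  rw [diag, ← hX, ddphi_coe]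
  ring

theorem jacobianIter_succ_zero (κ : ℝ) (p : Torus) (k : ℕ) (j : Fin 2) :
    jacobianIter κ p (k + 1) 0 j = jacobianIter κ p k 1 j := by
  simp [jacobianIter, jacobian, Matrix.mul_apply, Fin.sum_univ_two]

theorem jacobianIter_succ_one (κ : ℝ) (p : Torus) (k : ℕ) (j : Fin 2) :
    jacobianIter κ p (k + 1) 1 j =
      diag κ p (k + 1) * jacobianIter κ p k 1 j - jacobianIter κ p k 0 j := by
  simp [jacobianIter, jacobian, Matrix.mul_apply, Fin.sum_univ_two, diag, iterate_snd]
  ring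

/-- The first row holds the derivatives of `x_k`, and these satisfy the linearised Euler–Lagrange
equation. -/
theorem jacobianIter_recurrence (κ : ℝ) (p : Torus) (k : ℕ) (j : Fin 2) :
    diag κ p (k + 1) * jacobianIter κ p (k + 1) 0 j =
      jacobianIter κ p k 0 j + jacobianIter κ p (k + 2) 0 j := by
  rw [jacobianIter_succ_zero κ p (k + 1), jacobianIter_succ_one, jacobianIter_succ_zero]
  ring

theorem det_jacobianIter (κ : ℝ) (p : Torus) (k : ℕ) : (jacobianIter κ p k).det = 1 := by
  induction k with
  | zero => simp [jacobianIter]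
  | succ k ih =>
    rw [jacobianIter, Matrix.det_mul, ih]
    simp [jacobian, Matrix.det_fin_two]

/-- For an orbit dominated by its diagonal, the expansion is at least one and its sign is the
product of the signs of the diagonal. -/
theorem expansion_bounds {κ : ℝ} {p : Torus} {s : ℕ → ℤˣ} {r : ℕ}
    (h : ∀ l, l < r → 2 ≤ ((s (l + 1) : ℤ) : ℝ) * diag κ p (l + 1)) :
    1 ≤ (∏ l ∈ Finset.range r, ((s (l + 1) : ℤ) : ℝ)) * expansion κ (r + 1) p := by
  -- The induction also carries the growth of the modulus, which keeps the diagonal term dominant at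
  -- the next step.
  suffices H : ∀ k, k ≤ r →
      1 ≤ (∏ l ∈ Finset.range k, ((s (l + 1) : ℤ) : ℝ)) * jacobianIter κ p (k + 1) 0 1 ∧
      |jacobianIter κ p k 0 1| ≤ |jacobianIter κ p (k + 1) 0 1| from (H r le_rfl).1
  have hprod : ∀ k, |∏ l ∈ Finset.range k, ((s (l + 1) : ℤ) : ℝ)| = 1 := by
    intro k
    rw [Finset.abs_prod]
    exact Finset.prod_eq_one fun l _ => abs_units_cast _
  intro k
  induction k with
  | zero =>
    intro _
    rw [jacobianIter_succ_zero]
    simp [jacobianIter]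
  | succ k ih =>
    intro hk
    obtain ⟨ih1, ih2⟩ := ih (by omega)
    have hd := h k (by omega)
    have hrec := jacobianIter_recurrence κ p k 1
    set P := ∏ l ∈ Finset.range k, ((s (l + 1) : ℤ) : ℝ) with hP
    set a := jacobianIter κ p k 0 1
    set b := jacobianIter κ p (k + 1) 0 1
    set c := jacobianIter κ p (k + 1 + 1) 0 1
    set t := ((s (k + 1) : ℤ) : ℝ) with ht
    have ht1 : |t| = 1 := abs_units_cast _
    have hPb : |b| = P * b := by
      rw [← abs_of_nonneg (by linarith : 0 ≤ P * b), abs_mul, hprod, one_mul]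
    have hc : c = diag κ p (k + 1) * b - a := by linarith
    have hPta : P * t * a ≤ |b| := by
      refine (le_abs_self _).trans ?_
      rw [abs_mul, abs_mul, hprod, ht1, one_mul, one_mul]
      exact ih2
    have hmain : |b| ≤ P * t * c := by
      have e : P * t * c = (t * diag κ p (k + 1)) * (P * b) - P * t * a := by rw [hc]; ring
      rw [e, ← hPb]
      nlinarith [abs_nonneg b]
    constructor
    · rw [Finset.prod_range_succ, ← hP, ← ht]
      linarith
    · refine hmain.trans ((le_abs_self _).trans ?_)
      rw [abs_mul, abs_mul, hprod, ht1, one_mul, one_mul]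

/-- The linearised periodic problem has a solution, and its defect is `(Tr - 2) / α`. -/
theorem exists_linearised_solution {κ : ℝ} {p : Torus} {r : ℕ}
    (hp : coord κ p (r + 1) = coord κ p 0) (hα : expansion κ (r + 1) p ≠ 0) :
    ∃ u : ℕ → ℝ, u 0 = 1 ∧ u (r + 1) = 1 ∧
      (∀ l, diag κ p (l + 1) * u (l + 1) = u l + u (l + 2)) ∧
      expansion κ (r + 1) p * (diag κ p 0 - u 1 - u r) = (jacobianIter κ p (r + 1)).trace - 2 := by
  set α : ℕ → ℝ := fun k => jacobianIter κ p k 0 1 with hαdef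
  set β : ℕ → ℝ := fun k => jacobianIter κ p k 0 0 with hβdef
  have hαN : α (r + 1) ≠ 0 := hα
  have hdiag : diag κ p (r + 1) = diag κ p 0 := by rw [diag, diag, hp]
  have hrα : ∀ l, diag κ p (l + 1) * α (l + 1) = α l + α (l + 2) := fun l =>
    jacobianIter_recurrence κ p l 1
  have hrβ : ∀ l, diag κ p (l + 1) * β (l + 1) = β l + β (l + 2) := fun l =>
    jacobianIter_recurrence κ p l 0
  -- The determinant is the Wronskian of the two fundamental solutions `α` and `β`.
  have hdet : β r * α (r + 1) - α r * β (r + 1) = 1 := by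
    have := det_jacobianIter κ p r
    rw [Matrix.det_fin_two, ← jacobianIter_succ_zero, ← jacobianIter_succ_zero] at this
    exact this
  have htr : (jacobianIter κ p (r + 1)).trace = β (r + 1) + α (r + 2) := by
    rw [Matrix.trace_fin_two, ← jacobianIter_succ_zero]
  have hα0 : α 0 = 0 := by simp [hαdef, jacobianIter]
  have hα1 : α 1 = 1 := by simp [hαdef, jacobianIter_succ_zero, jacobianIter]
  have hβ0 : β 0 = 1 := by simp [hβdef, jacobianIter]
  have hβ1 : β 1 = 0 := by simp [hβdef, jacobianIter_succ_zero, jacobianIter]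
  -- The coefficient of `β` is forced by the value one at time 0, that of `α` by the value one at
  -- time `r + 1`.
  refine ⟨fun k => β k + (1 - β (r + 1)) / α (r + 1) * α k, ?_, ?_, ?_, ?_⟩
  · simp [hα0, hβ0]
  · simp only
    rw [div_mul_cancel₀ _ hαN]
    ring
  · intro l
    simp only
    linear_combination hrβ l + (1 - β (r + 1)) / α (r + 1) * hrα l
  · change α (r + 1) * _ = _
    simp only
    rw [hα1, hβ1, htr, ← hdiag]
    have e : α (r + 1) * ((1 - β (r + 1)) / α (r + 1)) = 1 - β (r + 1) :=
      mul_div_cancel₀ _ hαN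
    linear_combination hrα r - (1 + α r) * e - hdet

/-! ### Elliptic orbits in critical domains -/

/-- The sign of the strip visited at the time `l ≥ 1` by the orbits of a word. -/
def wordSign {r : ℕ} (ω : Word r) (l : ℕ) : ℤˣ :=
  -- Only the times from 1 to `r` enter the estimates; the values elsewhere are placeholders.
  if h : l - 1 < r then (ω.letter ⟨l - 1, h⟩).sign else 1

/-- The lift of an orbit in the critical domain of a word of length `r`. -/
def orbitLift {r : ℕ} (κ : ℝ) (ω : Word r) (p : Torus) (l : ℕ) : ℝ :=
  -- The same chart at both ends makes a periodic orbit close up in `ℝ`, not only modulo one.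
  if l = 0 ∨ l = r + 1 then chart .c ω.left (coord κ p l) else chart .d (wordSign ω l) (coord κ p l)

theorem coe_orbitLift {r : ℕ} (κ : ℝ) (ω : Word r) (p : Torus) (l : ℕ) :
    (orbitLift κ ω p l : UnitAddCircle) = coord κ p l := by
  rw [orbitLift]
  split_ifs <;> exact coe_chart _ _ _

theorem wordSign_succ {r : ℕ} (ω : Word r) (i : Fin r) :
    wordSign ω (i + 1) = (ω.letter i).sign := by
  simp [wordSign]

theorem orbitLift_succ {r : ℕ} (κ : ℝ) (ω : Word r) (p : Torus) (i : Fin r) :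
    orbitLift κ ω p (i + 1) = chart .d (ω.letter i).sign (coord κ p (i + 1)) := by
  have := i.2
  rw [orbitLift, if_neg (by omega), wordSign_succ]

theorem Kind.eq_d {z : Kind} (h : z ≠ .c) : z = .d := by
  cases z
  · exact absurd rfl h
  · rfl

/-- Compatibility of consecutive letters gives their common points the same chart, so the local
forces of all letters come from one global lift. -/
theorem orbitLift_prev {r : ℕ} {ω : Word r} (hω : ω.IsClosed) (κ : ℝ) (p : Torus) (i : Fin r) :
    orbitLift κ ω p i = chart (ω.letter i).prevKind (ω.letter i).prevSign (coord κ p i) := by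
  by_cases hi : (i : ℕ) = 0
  · rw [orbitLift, if_pos (Or.inl hi), (hω.prevKind_iff i).2 hi, hω.left_compatible i hi]
  · have h1 := i.2
    obtain ⟨j, hj⟩ : ∃ j : Fin r, (i : ℕ) = j + 1 := ⟨⟨i - 1, by omega⟩, by simp; omega⟩
    rw [Kind.eq_d (mt (hω.prevKind_iff i).1 hi), hj, orbitLift_succ, (hω.compatible j i hj).1]

theorem orbitLift_next {r : ℕ} {ω : Word r} (hω : ω.IsClosed) (hlr : ω.left = ω.right)
    (κ : ℝ) (p : Torus) (i : Fin r) :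
    orbitLift κ ω p (i + 2) =
      chart (ω.letter i).nextKind (ω.letter i).nextSign (coord κ p (i + 2)) := by
  have h1 := i.2
  by_cases hi : (i : ℕ) + 1 = r
  · rw [orbitLift, if_pos (Or.inr (by omega)), (hω.nextKind_iff i).2 hi, hω.right_compatible i hi,
      hlr]
  · obtain ⟨j, hj⟩ : ∃ j : Fin r, (j : ℕ) = i + 1 := ⟨⟨i + 1, by omega⟩, rfl⟩
    have hj2 : (i : ℕ) + 2 = j + 1 := by omega
    rw [Kind.eq_d (mt (hω.nextKind_iff i).1 hi), hj2, orbitLift_succ, (hω.compatible i j hj).2]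

theorem stdForce_orbitLift {r : ℕ} {ω : Word r} (hω : ω.IsClosed) (hlr : ω.left = ω.right)
    (κ : ℝ) (p : Torus) (i : Fin r) :
    stdForce κ (orbitLift κ ω p i) (orbitLift κ ω p (i + 1)) (orbitLift κ ω p (i + 2)) =
      symbolForce κ (ω.letter i) ((stdMap κ)^[(i : ℕ) + 1] p) := by
  rw [orbitLift_prev hω, orbitLift_succ, orbitLift_next hω hlr, symbolForce]
  have e1 : (stdMap κ).symm ((stdMap κ)^[(i : ℕ) + 1] p) = (stdMap κ)^[(i : ℕ)] p := by
    rw [Function.iterate_succ_apply', Equiv.symm_apply_apply]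
  have e2 : stdMap κ ((stdMap κ)^[(i : ℕ) + 1] p) = (stdMap κ)^[(i : ℕ) + 2] p := by
    rw [Function.iterate_succ_apply' _ (i + 1)]
  rw [e1, e2]
  rfl

theorem mem_region_of_mem_rectangle {κ : ℝ} {a : Symbol} {p : Torus} (hp : p ∈ rectangle κ a) :
    p ∈ region κ a := by
  obtain ⟨q, -, hpq⟩ := hp
  exact connectedComponentIn_subset _ _ hpq

/-- An elliptic periodic orbit in a critical domain lifts to a periodic chain whose defect has the
sign prescribed by the word and is controlled by the expansion. -/
theorem exists_periodicChain {M κ : ℝ} (hM : 1000000 ≤ M) (h₁ : M ^ 2 ≤ κ) (h₂ : κ ≤ M ^ 2 + 1)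
    {r : ℕ} {ω : Word r} {p : Torus} (hp : p ∈ criticalDomain ω κ)
    (hell : IsEllipticCyclicityOne κ (r + 1) p) :
    ω.left = ω.right ∧ ∃ (u : ℕ → ℝ) (ε : ℝ),
      PeriodicChain M κ (r + 1) ω.left (wordSign ω) (orbitLift κ ω p) u ε ∧
      1 ≤ |expansion κ (r + 1) p| ∧
      |ε| * |expansion κ (r + 1) p| ≤ 4 ∧
      (∏ l ∈ Finset.range r, ((wordSign ω (l + 1) : ℤ) : ℝ)) * ε < 0 := by
  obtain ⟨hp0, hpN, hpr⟩ := hp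
  obtain ⟨-, hper, -, hellip⟩ := hell
  have hMpos : 0 < M := by linarith
  have hfix : (stdMap κ)^[r + 1] p = p := by
    have := Function.iterate_minimalPeriod (f := stdMap κ) (x := p)
    rwa [hper] at this
  have hcl : coord κ p (r + 1) = coord κ p 0 := by rw [coord, hfix]; rfl
  obtain ⟨c1, c2, c3⟩ := chart_of_mem_proj_c hM h₁ h₂ hp0
  -- The point lies in both end strips, and the cosine has opposite signs on critical strips of
  -- different sign.
  have hlr : ω.left = ω.right := by
    rw [hfix] at hpN
    obtain ⟨-, c2', -⟩ := chart_of_mem_proj_c hM h₁ h₂ hpN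
    have e1 : Real.cos (2 * Real.pi * chart .c ω.left p.1) = dphi p.1 := by
      rw [← dphi_coe, coe_chart]
    have e2 : Real.cos (2 * Real.pi * chart .c ω.right p.1) = dphi p.1 := by
      rw [← dphi_coe, coe_chart]
    rw [e1] at c2
    rw [e2] at c2'
    rcases Int.units_eq_one_or ω.left with ha | ha <;>
      rcases Int.units_eq_one_or ω.right with hb | hb <;>
      rw [ha] at c2 ⊢ <;> rw [hb] at c2' ⊢ <;> push_cast at c2 c2' <;> linarith
  have hd : ∀ i : Fin r, coord κ p (i + 1) ∈ proj κ .d (ω.letter i).sign := fun i =>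
    (mem_region_of_mem_rectangle (hpr i)).2.1
  have hX0 : orbitLift κ ω p 0 = chart .c ω.left p.1 := by rw [orbitLift, if_pos (Or.inl rfl)]; rfl
  have hXN : orbitLift κ ω p (r + 1) = orbitLift κ ω p 0 := by
    rw [orbitLift, if_pos (Or.inr rfl), hcl, hX0]; rfl
  have hnear : ∀ l, l < r →
      |orbitLift κ ω p (l + 1) - center .d (wordSign ω (l + 1))| ≤ 1 / 4 ∧
      1 / M ≤ -((wordSign ω (l + 1) : ℤ) : ℝ) *
        Real.sin (2 * Real.pi * orbitLift κ ω p (l + 1)) := by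
    intro l hl
    have e1 := orbitLift_succ κ ω p ⟨l, hl⟩
    have e2 := wordSign_succ ω ⟨l, hl⟩
    simp only at e1 e2
    rw [e1, e2]
    exact chart_of_mem_proj_d hM h₁ h₂ (hd ⟨l, hl⟩)
  have hexp := expansion_bounds (κ := κ) (p := p) (s := wordSign ω) (r := r) (by
    intro l hl
    rw [diag_eq (coe_orbitLift κ ω p (l + 1))]
    have := le_abs_diag (by linarith) h₁ (hnear l hl).2
    linarith)
  set P := ∏ l ∈ Finset.range r, ((wordSign ω (l + 1) : ℤ) : ℝ) with hP
  have hPabs : |P| = 1 := by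
    rw [hP, Finset.abs_prod]
    exact Finset.prod_eq_one fun l _ => abs_units_cast _
  set α := expansion κ (r + 1) p with hα
  have hα1 : 1 ≤ |α| := by
    have := hexp.trans (le_abs_self _)
    rwa [abs_mul, hPabs, one_mul] at this
  obtain ⟨u, u0, uN, ulin, utr⟩ := exists_linearised_solution hcl (by
    intro h0
    rw [← hα] at h0
    rw [h0, abs_zero] at hα1
    linarith)
  rw [← hα] at utr
  set ε := diag κ p 0 - u 1 - u r with hε
  have htr : (jacobianIter κ p (r + 1)).trace ^ 2 < 4 := by
    rw [Matrix.IsElliptic, Matrix.discr_fin_two, det_jacobianIter] at hellip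
    linarith
  have htr' : |(jacobianIter κ p (r + 1)).trace| < 2 := by
    rw [← sq_lt_sq₀ (abs_nonneg _) zero_le_two, sq_abs]
    linarith
  rw [abs_lt] at htr'
  refine ⟨hlr, u, ε, ⟨h₁, h₂, hXN, ?_, ?_, ?_, ?_, ?_, u0, uN, ?_, ?_⟩, hα1, ?_, ?_⟩
  · rw [hX0]; exact c1
  · rw [hX0]; exact c2
  · rw [hX0]; exact c3
  · exact fun l hl => (hnear l (by omega)).1
  · exact fun l hl => (hnear l (by omega)).2
  · intro l _
    rw [← diag_eq (coe_orbitLift κ ω p (l + 1))]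
    exact ulin l
  · rw [← diag_eq (coe_orbitLift κ ω p 0), Nat.add_sub_cancel]
  · rw [← abs_mul, mul_comm, utr, abs_le]
    constructor <;> linarith [htr'.1, htr'.2]
  -- `α ε = Tr - 2` is negative, and `P α ≥ 1` says that `α` has the sign `P`.
  · have hneg : α * ε < 0 := by rw [utr]; linarith [htr'.2]
    have hP2 : P * P = 1 := by rw [← abs_mul_abs_self, hPabs, one_mul]
    by_contra! hcon
    have := mul_nonneg (zero_le_one.trans hexp) hcon
    have e : P * α * (P * ε) = (P * P) * (α * ε) := by ring
    rw [e, hP2, one_mul] at this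
    linarith

/-- The closing condition of a lifted periodic orbit is an integer. -/
theorem exists_int_closing {κ : ℝ} {r : ℕ} {ω : Word r} {p : Torus}
    (hfix : (stdMap κ)^[r + 1] p = p) :
    ∃ j : ℤ, stdForce κ (orbitLift κ ω p r) (orbitLift κ ω p 0) (orbitLift κ ω p 1) = j := by
  refine exists_int_stdForce (p := (stdMap κ)^[r] p) (coe_orbitLift _ _ _ _) ?_ ?_
  · have : coord κ p (r + 1) = p.1 := by rw [coord, hfix]
    rw [coe_orbitLift, iterate_snd, this]
    rfl
  · have : stdMap κ ((stdMap κ)^[r] p) = p := by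
      rw [← Function.iterate_succ_apply' (stdMap κ) r p]
      exact hfix
    rw [coe_orbitLift, this]
    rfl

theorem stdForce_orbitLift_eq {M κ₁ κ₂ : ℝ} (hM : 1000000 ≤ M) (h₁ : M ^ 2 ≤ κ₁)
    (h₁' : κ₁ ≤ M ^ 2 + 1) (h₂ : M ^ 2 ≤ κ₂) (h₂' : κ₂ ≤ M ^ 2 + 1)
    {r : ℕ} {ω : Word r} (hω : ω.IsClosed) (hlr : ω.left = ω.right) {p₁ p₂ : Torus}
    (hp₁ : p₁ ∈ criticalDomain ω κ₁) (hp₂ : p₂ ∈ criticalDomain ω κ₂) :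
    ∀ l, l + 1 < r + 1 →
      stdForce κ₂ (orbitLift κ₂ ω p₂ l) (orbitLift κ₂ ω p₂ (l + 1)) (orbitLift κ₂ ω p₂ (l + 2)) =
      stdForce κ₁ (orbitLift κ₁ ω p₁ l) (orbitLift κ₁ ω p₁ (l + 1))
        (orbitLift κ₁ ω p₁ (l + 2)) := by
  intro l hl
  have a1 := stdForce_orbitLift hω hlr κ₁ p₁ ⟨l, by omega⟩
  have a2 := stdForce_orbitLift hω hlr κ₂ p₂ ⟨l, by omega⟩
  simp only at a1 a2
  rw [a1, a2]
  exact symbolForce_eq hM h₂ h₂' h₁ h₁' (hp₂.2.2 ⟨l, by omega⟩) (hp₁.2.2 ⟨l, by omega⟩)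

/-! ### Parameter exclusion -/

/-- Both defects have the sign opposite to the word's sign product, so the two chains coincide; a
point is recovered from the coordinates at times 0 and 1. -/
theorem ellipticPoints_subsingleton {M κ : ℝ} (hM : 1000000 ≤ M) (h₁ : M ^ 2 ≤ κ)
    (h₂ : κ ≤ M ^ 2 + 1) {r : ℕ} {ω : Word r} (hω : ω.IsClosed) :
    {p | p ∈ criticalDomain ω κ ∧ IsEllipticCyclicityOne κ (r + 1) p}.Subsingleton := by
  rintro p ⟨hp, hpe⟩ q ⟨hq, hqe⟩
  obtain ⟨hlr, u, ε, hu, hα, hε, hs⟩ := exists_periodicChain hM h₁ h₂ hp hpe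
  obtain ⟨-, v, δ, hv, hβ, hδ, ht⟩ := exists_periodicChain hM h₁ h₂ hq hqe
  have hfix : ∀ x, IsEllipticCyclicityOne κ (r + 1) x → (stdMap κ)^[r + 1] x = x := by
    intro x hx
    have := Function.iterate_minimalPeriod (f := stdMap κ) (x := x)
    rwa [hx.2.1] at this
  obtain ⟨j₁, hj₁⟩ := exists_int_closing (ω := ω) (hfix p hpe)
  obtain ⟨j₂, hj₂⟩ := exists_int_closing (ω := ω) (hfix q hqe)
  have hpos : 0 < ε * δ := by
    have h := mul_pos_of_neg_of_neg hs ht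
    rw [mul_mul_mul_comm] at h
    exact pos_of_mul_pos_right h (mul_self_nonneg _)
  have key := PeriodicChain.eq_of_defect_mul_pos hM (by omega) hu hv
    (stdForce_orbitLift_eq hM h₁ h₂ h₁ h₂ hω hlr hp hq) hj₁ hj₂
    ((le_mul_of_one_le_right (abs_nonneg _) hα).trans hε)
    ((le_mul_of_one_le_right (abs_nonneg _) hβ).trans hδ) hpos
  have hcoord : ∀ l, l ≤ r + 1 → coord κ q l = coord κ p l := by
    intro l hl
    rw [← coe_orbitLift κ ω q, ← coe_orbitLift κ ω p, key l hl]
  exact Prod.ext (hcoord 0 (by omega)).symm (hcoord 1 (by omega)).symm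

/-- The closing integer of a point, with respect to the word `ω`. -/
def HasClosingInt {r : ℕ} (ω : Word r) (κ : ℝ) (p : Torus) (j : ℤ) : Prop :=
  stdForce κ (orbitLift κ ω p r) (orbitLift κ ω p 0) (orbitLift κ ω p 1) = j

/-- Parameters whose elliptic points have the same closing integer and expansions at least `L` are
close to each other. -/
theorem abs_param_sub_le_of_hasClosingInt {M κ₁ κ₂ L : ℝ} (hM : 1000000 ≤ M) (h₁ : M ^ 2 ≤ κ₁)
    (h₁' : κ₁ ≤ M ^ 2 + 1) (h₂ : M ^ 2 ≤ κ₂) (h₂' : κ₂ ≤ M ^ 2 + 1) {r : ℕ} {ω : Word r}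
    (hω : ω.IsClosed) {p₁ p₂ : Torus} (hp₁ : p₁ ∈ criticalDomain ω κ₁)
    (hp₂ : p₂ ∈ criticalDomain ω κ₂) (he₁ : IsEllipticCyclicityOne κ₁ (r + 1) p₁)
    (he₂ : IsEllipticCyclicityOne κ₂ (r + 1) p₂) {j : ℤ} (hj₁ : HasClosingInt ω κ₁ p₁ j)
    (hj₂ : HasClosingInt ω κ₂ p₂ j) (hL : 0 < L) (hL₁ : L ≤ |expansion κ₁ (r + 1) p₁|)
    (hL₂ : L ≤ |expansion κ₂ (r + 1) p₂|) : |κ₂ - κ₁| ≤ 80 / (M ^ 2 * L ^ 2) := by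
  obtain ⟨hlr, u, ε, hu, hα, hε, -⟩ := exists_periodicChain hM h₁ h₁' hp₁ he₁
  obtain ⟨-, v, δ, hv, hβ, hδ, -⟩ := exists_periodicChain hM h₂ h₂' hp₂ he₂
  -- `L` may be smaller than one, so the required `η ≤ 4` comes from `|α| ≥ 1`, and `4 / L` gives
  -- the decay.
  have bound : ∀ {e a : ℝ}, 1 ≤ |a| → |e| * |a| ≤ 4 → L ≤ |a| → |e| ≤ min 4 (4 / L) := by
    intro e a ha hea hLa
    refine le_min ((le_mul_of_one_le_right (abs_nonneg _) ha).trans hea) ?_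
    rw [le_div_iff₀ hL]
    exact (mul_le_mul_of_nonneg_left hLa (abs_nonneg _)).trans hea
  have h := PeriodicChain.abs_param_sub_le_of_closing hM (by omega) hu hv
    (stdForce_orbitLift_eq hM h₁ h₁' h₂ h₂' hω hlr hp₁ hp₂) (hj₂.trans hj₁.symm)
    (min_le_left 4 (4 / L)) (bound hα hε hL₁) (bound hβ hδ hL₂)
  refine h.trans ?_
  have hMpos : 0 < M := by linarith
  have hmin : min 4 (4 / L) ^ 2 ≤ (4 / L) ^ 2 := by
    gcongr
    exact min_le_right _ _
  calc 5 * min 4 (4 / L) ^ 2 / M ^ 2 ≤ 5 * (4 / L) ^ 2 / M ^ 2 := by gcongr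
    _ = _ := by field_simp; norm_num

/-! ### Measure of the elliptic parameters -/

theorem paramSet_bounds {n : ℕ} {M κ : ℝ} (hM : M ^ 2 = kappaA n) (hκ : κ ∈ paramSet n) :
    M ^ 2 ≤ κ ∧ κ ≤ M ^ 2 + 1 := by
  rw [paramSet, Set.mem_Icc] at hκ
  rw [hM]
  refine ⟨hκ.1, hκ.2.trans ?_⟩
  rw [kappaA, kappaB]
  linarith

/-- Elliptic parameters with a given closing integer. -/
def ellipticParamsAt (n : ℕ) {r : ℕ} (ω : Word r) (j : ℤ) : Set ℝ :=
  {κ | κ ∈ admissibleParams n ω ∧ ∃ p ∈ criticalDomain ω κ, IsEllipticCyclicityOne κ (r + 1) p ∧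
    HasClosingInt ω κ p j}

theorem volume_ellipticParamsAt_le {n : ℕ} {M : ℝ} (hM : 1000000 ≤ M) (hMn : M ^ 2 = kappaA n)
    {r : ℕ} (ω : Word r) (j : ℤ) :
    volume (ellipticParamsAt n ω j) ≤
      ENNReal.ofReal (80 * (kappaA n)⁻¹) * (minExpansion n ω ^ 2)⁻¹ := by
  have hMpos : 0 < M := by linarith
  have hA : 0 < kappaA n := by rw [← hMn]; positivity
  -- A vanishing minimal expansion makes the right side infinite.
  by_cases hzero : minExpansion n ω = 0
  · rw [hzero, zero_pow two_ne_zero, ENNReal.inv_zero, ENNReal.mul_top]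
    · exact le_top
    · rw [Ne, ENNReal.ofReal_eq_zero, not_le]; positivity
  have hmin : ∀ κ ∈ admissibleParams n ω, ∀ p ∈ criticalDomain ω κ,
      minExpansion n ω ≤ ‖expansion κ (r + 1) p‖ₑ := fun κ hκ p hp =>
    (iInf₂_le κ hκ).trans (iInf₂_le p hp)
  rcases (ellipticParamsAt n ω j).eq_empty_or_nonempty with hE | ⟨κ₀, hκ₀, p₀, hp₀, -, -⟩
  · rw [hE, measure_empty]; exact zero_le
  have htop : minExpansion n ω ≠ ⊤ := ne_top_of_le_ne_top enorm_ne_top (hmin κ₀ hκ₀ p₀ hp₀)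
  obtain ⟨L, hL⟩ : ∃ L, L = (minExpansion n ω).toReal := ⟨_, rfl⟩
  have hLpos : 0 < L := by rw [hL]; exact ENNReal.toReal_pos hzero htop
  have hLeq : minExpansion n ω = ENNReal.ofReal L := by rw [hL, ENNReal.ofReal_toReal htop]
  have hLle : ∀ κ ∈ admissibleParams n ω, ∀ p ∈ criticalDomain ω κ,
      L ≤ |expansion κ (r + 1) p| := by
    intro κ hκ p hp
    have := hmin κ hκ p hp
    rw [hLeq, Real.enorm_eq_ofReal_abs] at this
    exact (ENNReal.ofReal_le_ofReal_iff (abs_nonneg _)).1 this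
  have hrhs : ENNReal.ofReal (80 * (kappaA n)⁻¹) * (minExpansion n ω ^ 2)⁻¹ =
      ENNReal.ofReal (80 / (M ^ 2 * L ^ 2)) := by
    rw [hLeq, ← ENNReal.ofReal_pow hLpos.le, ← ENNReal.ofReal_inv_of_pos (by positivity),
      ← ENNReal.ofReal_mul (by positivity), hMn]
    congr 1
    field_simp
  rw [hrhs]
  refine (Real.volume_le_diam _).trans (Metric.ediam_le ?_)
  rintro κ₂ ⟨hκ₂, p₂, hp₂, he₂, hj₂⟩ κ₁ ⟨hκ₁, p₁, hp₁, he₁, hj₁⟩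
  obtain ⟨a1, a2⟩ := paramSet_bounds hMn hκ₁.1
  obtain ⟨b1, b2⟩ := paramSet_bounds hMn hκ₂.1
  rw [edist_dist, Real.dist_eq]
  exact ENNReal.ofReal_le_ofReal (abs_param_sub_le_of_hasClosingInt hM a1 a2 b1 b2 hκ₁.2.1 hp₁ hp₂
    he₁ he₂ hj₁ hj₂ hLpos (hLle κ₁ hκ₁ p₁ hp₁) (hLle κ₂ hκ₂ p₂ hp₂))

/-- The closing integer lies within 2000 of `-σ M²`; rounding this centre down adds one, leaving
4003 values whatever the word. -/
theorem ellipticParams_subset {n : ℕ} {M : ℝ} (hM : 1000000 ≤ M) (hMn : M ^ 2 = kappaA n)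
    {r : ℕ} (ω : Word r) :
    ellipticParams n (r + 1) ω ⊆ ⋃ i ∈ Finset.Icc (-2001 : ℤ) 2001,
      ellipticParamsAt n ω (i + ⌊-(((ω.left : ℤ) : ℝ) * M ^ 2)⌋) := by
  rintro κ ⟨hκ, p, hp, hpe⟩
  obtain ⟨a1, a2⟩ := paramSet_bounds hMn hκ.1
  obtain ⟨-, u, ε, hu, -⟩ := exists_periodicChain hM a1 a2 hp hpe
  have hfix : (stdMap κ)^[r + 1] p = p := by
    have := Function.iterate_minimalPeriod (f := stdMap κ) (x := p)
    rwa [hpe.2.1] at this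
  obtain ⟨j, hj⟩ := exists_int_closing (ω := ω) hfix
  have hb := hu.abs_closing_add_le hM (by omega)
  rw [Nat.add_sub_cancel, hj, abs_le] at hb
  set x := -(((ω.left : ℤ) : ℝ) * M ^ 2) with hx
  have hf1 := Int.floor_le x
  have hf2 := Int.lt_floor_add_one x
  simp only [Set.mem_iUnion, Finset.mem_Icc]
  refine ⟨j - ⌊x⌋, ⟨?_, ?_⟩, hκ, p, hp, hpe, ?_⟩
  · have : (-2001 : ℝ) ≤ j - ⌊x⌋ := by linarith [hb.1]
    exact_mod_cast this
  · have : (j : ℝ) - ⌊x⌋ ≤ 2001 := by linarith [hb.2]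
    exact_mod_cast this
  · rw [sub_add_cancel]
    exact hj

theorem volume_ellipticParams_le {n : ℕ} {M : ℝ} (hM : 1000000 ≤ M) (hMn : M ^ 2 = kappaA n)
    {r : ℕ} (ω : Word r) :
    volume (ellipticParams n (r + 1) ω) ≤
      4003 * (ENNReal.ofReal (80 * (kappaA n)⁻¹) * (minExpansion n ω ^ 2)⁻¹) := by
  refine (measure_mono (ellipticParams_subset hM hMn ω)).trans
    ((measure_biUnion_finset_le _ _).trans ?_)
  refine (Finset.sum_le_card_nsmul _ _ _ fun i _ => volume_ellipticParamsAt_le hM hMn ω _).trans ?_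
  rw [nsmul_eq_mul]
  gcongr
  simp

theorem volume_paramSet (n : ℕ) : volume (paramSet n) = ENNReal.ofReal (7 / 8) := by
  rw [paramSet, Real.volume_Icc, kappaA, kappaB]
  congr 1
  ring

end StandardFamily

end

theorem mainTheorem2 :
    ∃ C : ℝ, 0 < C ∧ ∃ n₀ : ℕ, ∀ n : ℕ, n₀ ≤ n → ∀ N : ℕ, 1 ≤ N →
      ∀ ω : StandardFamily.Word (N - 1),
        ω ∈ StandardFamily.closedWords (N - 1) (StandardFamily.kappaB n) →
        (ProbabilityTheory.cond volume (StandardFamily.paramSet n)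
            (StandardFamily.ellipticParams n N ω) ≤
          ENNReal.ofReal (C * (StandardFamily.kappaA n)⁻¹) *
            (StandardFamily.minExpansion n ω ^ 2)⁻¹) ∧
        ∀ κ ∈ StandardFamily.admissibleParams n ω,
          {p | p ∈ StandardFamily.criticalDomain ω κ ∧
            StandardFamily.IsEllipticCyclicityOne κ N p}.Subsingleton := by
  -- The factors are the normalisation of the measure, the number of closing integers and the
  -- diameter constant; the value of `n₀` ensures `√κ_a ≥ 10⁶`.
  refine ⟨(7 / 8)⁻¹ * (4003 * 80), by norm_num, 4000000000000, fun n hn N hN ω _ => ?_⟩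
  obtain ⟨r, rfl⟩ : ∃ r, N = r + 1 := ⟨N - 1, by omega⟩
  have hA : (1000000 : ℝ) ^ 2 ≤ StandardFamily.kappaA n := by
    have : (4000000000000 : ℝ) ≤ n := by exact_mod_cast hn
    rw [StandardFamily.kappaA]
    norm_num
    linarith
  have hA0 : 0 ≤ StandardFamily.kappaA n := le_trans (by positivity) hA
  obtain ⟨M, hM, hMn⟩ : ∃ M : ℝ, 1000000 ≤ M ∧ M ^ 2 = StandardFamily.kappaA n :=
    ⟨√(StandardFamily.kappaA n), Real.le_sqrt_of_sq_le hA, Real.sq_sqrt hA0⟩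
  constructor
  · rw [ProbabilityTheory.cond_apply (by exact measurableSet_Icc), StandardFamily.volume_paramSet,
      ← ENNReal.ofReal_inv_of_pos (by norm_num)]
    calc _ ≤ ENNReal.ofReal (7 / 8)⁻¹ * (4003 * (ENNReal.ofReal (80 * (StandardFamily.kappaA n)⁻¹) *
          (StandardFamily.minExpansion n ω ^ 2)⁻¹)) := by
          gcongr
          exact (measure_mono Set.inter_subset_right).trans
            (StandardFamily.volume_ellipticParams_le hM hMn ω)
      _ = _ := by
          have e : (4003 : ℝ≥0∞) = ENNReal.ofReal 4003 := by norm_num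
          rw [e, ← mul_assoc, ← mul_assoc, ← ENNReal.ofReal_mul (by positivity),
            ← ENNReal.ofReal_mul (by positivity)]
          congr 2
          ring
  · intro κ hκ
    obtain ⟨a1, a2⟩ := StandardFamily.paramSet_bounds hMn hκ.1
    exact StandardFamily.ellipticPoints_subsingleton hM a1 a2 hκ.2.1
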